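/- Let $\overline{E(2)}$ be the projective covering group of the Euclidean group of the plane (the universal cover of the oscillator group): the set of triples $(s,a,\phi)$, $s\in\mathbb R$, $a=(a_x,a_y)\in\mathbb R^2$, $\phi\in\mathbb R$, with the topology of $\mathbb R^4$ and the multiplication $$(s,a,\phi)(s',a',\phi')=\bigl(s+s'+\tfrac12\,a\times R_\phi a',\ a+R_\phi a',\ \phi+\phi'\bigr),$$ where $a\times b=a_xb_y-a_yb_x$ and $R_\phi$ is the rotation by the angle $\phi$. Its one-parameter subgroups $(t,0,0)$, $(0,(t,0),0)$, $(0,(0,t),0)$, $(0,0,t)$ are generated by $E,P_1,P_2,J$, with $[P_1,P_2]=E$ central, $[J,P_1]=P_2$, $[J,P_2]=-P_1$. For a strongly continuous unitary representation $\pi$ of $\overline{E(2)}$, the generator of $\pi$ along a one-parameter subgroup $\gamma$ is the self-adjoint operator $A$ with $\pi(\gamma(t))=e^{-itA}$, that is, $A\psi=i\,\frac{d}{dt}\big|_{t=0}\pi(\gamma(t))\psi$ on the domain of all $\psi$ for which the derivative exists. Denote by $\hat E,\hat P_x,\hat P_y,\hat J$ the generators along the four subgroups above. Let $Q$ be the position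 operator, $(Q\psi)(x)=x\psi(x)$, with domain $\{\psi\in L^2(\mathbb R): x\psi\in L^2(\mathbb R)\}$, and let $P=-i\frac{d}{dx}$ be the momentum operator, with domain $\{\psi\in L^2(\mathbb R):\psi'\in L^2(\mathbb R)\}$ ($\psi'$ the weak derivative). **Theorem.** For each real $\mu\neq0$ there exists an irreducible strongly continuous unitary representation $\tilde\pi_\mu$ of $\overline{E(2)}$ on $L^2(\mathbb R)$ such that $$\hat E=\mu\,\mathbf 1,\qquad \hat P_x=\sqrt{|\mu|}\,Q,\qquad \hat P_y=\operatorname{sgn}(\mu)\sqrt{|\mu|}\,P,\qquad \hat J=-\operatorname{sgn}(\mu)\,\tfrac12\,(Q^2+P^2),$$ as equalities of unbounded operators, domains included, where $Q^2+P^2$ has the domain $D(Q^2)\cap D(P^2)$. -/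

import Mathlib

open MeasureTheory
open scoped ContDiff ENNReal

noncomputable section

/-! ### The projective covering group of the Euclidean group of the plane -/

/-- The group `Ē(2) = H(2) ⋊ ℝ` in its global coordinates `(s, a, φ)`, `a = (ax, ay) ∈ ℝ²`. -/
@[ext]
structure EBar where
  s : ℝ
  ax : ℝ
  ay : ℝ
  φ : ℝ

namespace EBar

/-- First coordinate of `R_φ (x, y)`, where `R_φ` is the rotation by the angle `φ`. -/
def rotX (φ x y : ℝ) : ℝ := Real.cos φ * x - Real.sin φ * y

/-- Second coordinate of `R_φ (x, y)`. -/
def rotY (φ x y : ℝ) : ℝ := Real.sin φ * x + Real.cos φ * y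

/-- `(s, a, φ) (s', a', φ') = (s + s' + ½ a × R_φ a', a + R_φ a', φ + φ')`,
where `a × b = a_x b_y - a_y b_x`. -/
instance : Mul EBar where
  mul g h :=
    { s := g.s + h.s + (1 / 2) * (g.ax * rotY g.φ h.ax h.ay - g.ay * rotX g.φ h.ax h.ay)
      ax := g.ax + rotX g.φ h.ax h.ay
      ay := g.ay + rotY g.φ h.ax h.ay
      φ := g.φ + h.φ }

instance : One EBar where
  one := { s := 0, ax := 0, ay := 0, φ := 0 }

/-- `(s, a, φ)⁻¹ = (-s, -R_{-φ} a, -φ)`. -/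
instance : Inv EBar where
  inv g :=
    { s := -g.s
      ax := -rotX (-g.φ) g.ax g.ay
      ay := -rotY (-g.φ) g.ax g.ay
      φ := -g.φ }

theorem mul_def (g h : EBar) : g * h =
    { s := g.s + h.s + (1 / 2) * (g.ax * rotY g.φ h.ax h.ay - g.ay * rotX g.φ h.ax h.ay)
      ax := g.ax + rotX g.φ h.ax h.ay
      ay := g.ay + rotY g.φ h.ax h.ay
      φ := g.φ + h.φ } := rfl

theorem one_def : (1 : EBar) = { s := 0, ax := 0, ay := 0, φ := 0 } := rfl

theorem inv_def (g : EBar) : g⁻¹ =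
    { s := -g.s
      ax := -rotX (-g.φ) g.ax g.ay
      ay := -rotY (-g.φ) g.ax g.ay
      φ := -g.φ } := rfl

instance : Group EBar :=
  Group.ofLeftAxioms
    (by
      intro g h k
      ext <;> simp only [mul_def, rotX, rotY, Real.cos_add, Real.sin_add]
      · linear_combination
          (1 / 2) * (h.ax * (Real.sin h.φ * k.ax + Real.cos h.φ * k.ay)
            - h.ay * (Real.cos h.φ * k.ax - Real.sin h.φ * k.ay)) * Real.sin_sq_add_cos_sq g.φ
      · ring
      · ring
      · ring)
    (by
      intro g
      ext <;> simp [mul_def, one_def, rotX, rotY])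
    (by
      intro g
      ext <;> simp [mul_def, one_def, inv_def, rotX, rotY]
      ring)

/-- The coordinates identify `Ē(2)` with `ℝ × (ℝ × ℝ) × ℝ`. -/
def coords : EBar ≃ ℝ × (ℝ × ℝ) × ℝ where
  toFun g := (g.s, (g.ax, g.ay), g.φ)
  invFun p := { s := p.1, ax := p.2.1.1, ay := p.2.1.2, φ := p.2.2 }
  left_inv _ := rfl
  right_inv _ := rfl

/-- The topology of `ℝ⁴`, through the global coordinates. -/
instance : TopologicalSpace EBar := TopologicalSpace.induced coords inferInstance

theorem continuous_coords : Continuous coords := continuous_induced_dom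

theorem continuous_s : Continuous EBar.s := continuous_fst.comp continuous_coords

theorem continuous_ax : Continuous EBar.ax :=
  (continuous_fst.comp (continuous_fst.comp continuous_snd)).comp continuous_coords

theorem continuous_ay : Continuous EBar.ay :=
  (continuous_snd.comp (continuous_fst.comp continuous_snd)).comp continuous_coords

theorem continuous_angle : Continuous EBar.φ :=
  (continuous_snd.comp continuous_snd).comp continuous_coords

instance : IsTopologicalGroup EBar where
  continuous_mul := by
    have h1 := continuous_s
    have h2 := continuous_ax
    have h3 := continuous_ay
    have h4 := continuous_angle
    refine continuous_induced_rng.2 ?_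
    change Continuous fun p : EBar × EBar => coords (p.1 * p.2)
    simp only [coords, mul_def, rotX, rotY, Equiv.coe_fn_mk]
    fun_prop
  continuous_inv := by
    have h1 := continuous_s
    have h2 := continuous_ax
    have h3 := continuous_ay
    have h4 := continuous_angle
    refine continuous_induced_rng.2 ?_
    change Continuous fun p : EBar => coords p⁻¹
    simp only [coords, inv_def, rotX, rotY, Equiv.coe_fn_mk]
    fun_prop

/-- The one-parameter subgroup `t ↦ exp (t E)`. -/
def expE (t : ℝ) : EBar := { s := t, ax := 0, ay := 0, φ := 0 }

/-- The one-parameter subgroup `t ↦ exp (t P₁)`. -/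
def expPx (t : ℝ) : EBar := { s := 0, ax := t, ay := 0, φ := 0 }

/-- The one-parameter subgroup `t ↦ exp (t P₂)`. -/
def expPy (t : ℝ) : EBar := { s := 0, ax := 0, ay := t, φ := 0 }

/-- The one-parameter subgroup `t ↦ exp (t J)`. -/
def expJ (t : ℝ) : EBar := { s := 0, ax := 0, ay := 0, φ := t }

end EBar

/-! ### Unitary representations and their generators -/

/-- A (strongly continuous) unitary representation of `G` on the Hilbert space `H`. -/
structure UnitaryRep (G : Type*) [Group G] [TopologicalSpace G]
    (H : Type*) [NormedAddCommGroup H] [InnerProductSpace ℂ H] [CompleteSpace H] where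
  toHom : G →* unitary (H →L[ℂ] H)
  continuous_apply : ∀ v : H, Continuous fun g => (toHom g : H →L[ℂ] H) v

namespace UnitaryRep

variable {G : Type*} [Group G] [TopologicalSpace G]
  {H : Type*} [NormedAddCommGroup H] [InnerProductSpace ℂ H] [CompleteSpace H]

/-- The operator `π g`. -/
def op (π : UnitaryRep G H) (g : G) : H →L[ℂ] H := (π.toHom g : H →L[ℂ] H)

/-- Irreducibility: the space is not zero, and its only closed invariant subspaces are `0` and the
whole space. -/
def IsIrreducible (π : UnitaryRep G H) : Prop :=
  Nontrivial H ∧ ∀ W : Submodule ℂ H, IsClosed (W : Set H) →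
    (∀ g, ∀ v ∈ W, π.op g v ∈ W) → W = ⊥ ∨ W = ⊤

end UnitaryRep

section Operators

variable {H : Type*} [NormedAddCommGroup H] [InnerProductSpace ℂ H]

/-- The generator `A` of a one-parameter family of operators `U t = e^{-itA}`, as an unbounded
operator with its full domain: `A v = i (d/dt) (U t v)` at `t = 0`, for all the vectors `v` at
which the derivative exists. -/
def generator (U : ℝ → H →L[ℂ] H) : H →ₗ.[ℂ] H where
  domain :=
    { carrier := {v | DifferentiableAt ℝ (fun t => U t v) 0}
      add_mem' := by
        intro v w hv hw
        simpa using DifferentiableAt.fun_add hv hw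
      zero_mem' := by simp
      smul_mem' := by
        intro c v hv
        simpa using DifferentiableAt.fun_const_smul (R := ℂ) hv c }
  toFun :=
    { toFun := fun v => Complex.I • deriv (fun t => U t (v : H)) 0
      map_add' := by
        rintro ⟨v, hv⟩ ⟨w, hw⟩
        have := deriv_fun_add (𝕜 := ℝ) (f := fun t => U t v) (g := fun t => U t w) hv hw
        simp only [Submodule.coe_add, map_add, this, smul_add]
      map_smul' := by
        rintro c ⟨v, hv⟩
        have := deriv_fun_const_smul (𝕜 := ℝ) (R := ℂ) (f := fun t => U t v) (x := 0) c hv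
        simp only [SetLike.val_smul, map_smul, this, RingHom.id_apply]
        rw [smul_comm] }

/-- The identity, as an everywhere defined operator. -/
def idOp : H →ₗ.[ℂ] H := (LinearMap.id : H →ₗ[ℂ] H).toPMap ⊤

/-- The product `A B` of unbounded operators, defined at the `v ∈ D(B)` with `B v ∈ D(A)`. -/
def opMul (A B : H →ₗ.[ℂ] H) : H →ₗ.[ℂ] H where
  domain :=
    { carrier := {v | ∃ h : v ∈ B.domain, B ⟨v, h⟩ ∈ A.domain}
      add_mem' := by
        rintro v w ⟨hv, hv'⟩ ⟨hw, hw'⟩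
        refine ⟨B.domain.add_mem hv hw, ?_⟩
        have := B.map_add ⟨v, hv⟩ ⟨w, hw⟩
        exact this ▸ A.domain.add_mem hv' hw'
      zero_mem' := by
        refine ⟨B.domain.zero_mem, ?_⟩
        have h : B ⟨0, B.domain.zero_mem⟩ = 0 := B.map_zero
        rw [h]
        exact A.domain.zero_mem
      smul_mem' := by
        rintro c v ⟨hv, hv'⟩
        refine ⟨B.domain.smul_mem c hv, ?_⟩
        have := B.map_smul c ⟨v, hv⟩
        exact this ▸ A.domain.smul_mem c hv' }
  toFun :=
    { toFun := fun v => A ⟨B ⟨v, v.2.1⟩, v.2.2⟩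
      map_add' := by
        rintro ⟨v, hv⟩ ⟨w, hw⟩
        rw [← A.map_add]
        congr 1
        exact Subtype.ext (B.map_add ⟨v, hv.1⟩ ⟨w, hw.1⟩)
      map_smul' := by
        rintro c ⟨v, hv⟩
        rw [RingHom.id_apply, ← A.map_smul]
        congr 1
        exact Subtype.ext (B.map_smul c ⟨v, hv.1⟩) }

end Operators

/-! ### Position and momentum on `L²(ℝ)` -/

/-- The Hilbert space `L²(ℝ)` of complex functions. -/
abbrev L2R : Type := Lp ℂ 2 (volume : Measure ℝ)

theorem mul_add_ae (v w : L2R) : (fun x : ℝ => (x : ℂ) * (v + w : L2R) x) =ᵐ[volume]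
    (fun x : ℝ => (x : ℂ) * v x) + fun x : ℝ => (x : ℂ) * w x := by
  filter_upwards [Lp.coeFn_add v w] with x hx
  simp only [hx, Pi.add_apply, mul_add]

theorem mul_smul_ae (c : ℂ) (v : L2R) : (fun x : ℝ => (x : ℂ) * (c • v : L2R) x) =ᵐ[volume]
    c • fun x : ℝ => (x : ℂ) * v x := by
  filter_upwards [Lp.coeFn_smul c v] with x hx
  simp only [hx, Pi.smul_apply, smul_eq_mul]
  ring

/-- The position operator `(Q ψ)(x) = x ψ(x)` on `{ψ ∈ L² | x ψ ∈ L²}`. -/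
def positionOp : L2R →ₗ.[ℂ] L2R where
  domain :=
    { carrier := {v | MemLp (fun x : ℝ => (x : ℂ) * v x) 2 volume}
      add_mem' := by
        intro v w hv hw
        exact (memLp_congr_ae (mul_add_ae v w)).2 (MemLp.add hv hw)
      zero_mem' := by
        have h : (fun x : ℝ => (x : ℂ) * (0 : L2R) x) =ᵐ[volume] 0 := by
          filter_upwards [Lp.coeFn_zero ℂ 2 (volume : Measure ℝ)] with x hx
          simp only [hx, Pi.zero_apply, mul_zero]
        exact (memLp_congr_ae h).2 MemLp.zero
      smul_mem' := by
        intro c v hv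
        exact (memLp_congr_ae (mul_smul_ae c v)).2 (MemLp.const_smul hv c) }
  toFun :=
    { toFun := fun v => MemLp.toLp (fun x : ℝ => (x : ℂ) * (v : L2R) x) v.2
      map_add' := by
        rintro ⟨v, hv⟩ ⟨w, hw⟩
        refine Lp.ext ?_
        filter_upwards [MemLp.coeFn_toLp hv, MemLp.coeFn_toLp hw,
          MemLp.coeFn_toLp ((memLp_congr_ae (mul_add_ae v w)).2 (MemLp.add hv hw)),
          Lp.coeFn_add (MemLp.toLp _ hv) (MemLp.toLp _ hw), mul_add_ae v w] with x h1 h2 h3 h4 h5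
        rw [h4, Pi.add_apply, h1, h2]
        exact h3.trans h5
      map_smul' := by
        rintro c ⟨v, hv⟩
        refine Lp.ext ?_
        filter_upwards [MemLp.coeFn_toLp hv,
          MemLp.coeFn_toLp ((memLp_congr_ae (mul_smul_ae c v)).2 (MemLp.const_smul hv c)),
          Lp.coeFn_smul c (MemLp.toLp _ hv), mul_smul_ae c v] with x h1 h3 h4 h5
        rw [RingHom.id_apply, h4, Pi.smul_apply, h1]
        exact h3.trans h5 }

/-- `w` is the weak derivative of `v`: `∫ g' v = -∫ g w` for all test functions `g`. -/
def IsWeakDeriv (v w : L2R) : Prop :=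
  ∀ g : ℝ → ℝ, ContDiff ℝ ∞ g → HasCompactSupport g →
    ∫ x, deriv g x • v x = -∫ x, g x • w x

theorem integrable_test_smul {g : ℝ → ℝ} (hg : Continuous g) (hc : HasCompactSupport g)
    (v : L2R) : Integrable (fun x => g x • v x) volume :=
  ((Lp.memLp v).locallyIntegrable (by norm_num)).integrable_smul_left_of_hasCompactSupport hg hc

theorem IsWeakDeriv.unique {v w w' : L2R} (h : IsWeakDeriv v w) (h' : IsWeakDeriv v w') :
    w = w' := by
  apply Lp.ext
  refine ae_eq_of_integral_contDiff_smul_eq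
    ((Lp.memLp w).locallyIntegrable (by norm_num))
    ((Lp.memLp w').locallyIntegrable (by norm_num)) ?_
  intro g hg hc
  exact neg_injective ((h g hg hc).symm.trans (h' g hg hc))

theorem integral_test_add {g : ℝ → ℝ} (hg : Continuous g) (hc : HasCompactSupport g)
    (v w : L2R) : ∫ x, g x • (v + w : L2R) x = (∫ x, g x • v x) + ∫ x, g x • w x := by
  rw [← integral_add (integrable_test_smul hg hc v) (integrable_test_smul hg hc w)]
  apply integral_congr_ae
  filter_upwards [Lp.coeFn_add v w] with x hx
  simp only [hx, Pi.add_apply, smul_add]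

theorem integral_test_smul (g : ℝ → ℝ) (c : ℂ) (v : L2R) :
    ∫ x, g x • (c • v : L2R) x = c • ∫ x, g x • v x := by
  rw [← integral_smul]
  apply integral_congr_ae
  filter_upwards [Lp.coeFn_smul c v] with x hx
  simp only [hx, Pi.smul_apply]
  rw [smul_comm]

theorem IsWeakDeriv.add {v w v' w' : L2R} (h : IsWeakDeriv v w) (h' : IsWeakDeriv v' w') :
    IsWeakDeriv (v + v') (w + w') := by
  intro g hg hc
  rw [integral_test_add (hg.continuous_deriv (by simp)) hc.deriv,
    integral_test_add hg.continuous hc, h g hg hc, h' g hg hc, neg_add]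

theorem IsWeakDeriv.smul (c : ℂ) {v w : L2R} (h : IsWeakDeriv v w) :
    IsWeakDeriv (c • v) (c • w) := by
  intro g hg hc
  rw [integral_test_smul, integral_test_smul, h g hg hc, smul_neg]

theorem IsWeakDeriv.zero : IsWeakDeriv 0 0 := by
  have h (g : ℝ → ℝ) : ∫ x, g x • (0 : L2R) x = 0 := by
    have := integral_test_smul g 0 0
    rwa [zero_smul, zero_smul] at this
  intro g _ _
  rw [h, h, neg_zero]

/-- The momentum operator `P ψ = -i dψ/dx` on `{ψ ∈ L² | ψ has a weak derivative in L²}`. -/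
def momentumOp : L2R →ₗ.[ℂ] L2R where
  domain :=
    { carrier := {v | ∃ w, IsWeakDeriv v w}
      add_mem' := by
        rintro v v' ⟨w, h⟩ ⟨w', h'⟩
        exact ⟨w + w', h.add h'⟩
      zero_mem' := ⟨0, IsWeakDeriv.zero⟩
      smul_mem' := by
        rintro c v ⟨w, h⟩
        exact ⟨c • w, h.smul c⟩ }
  toFun :=
    { toFun := fun v => (-Complex.I) • Classical.choose v.2
      map_add' := by
        intro v v'
        rw [← smul_add]
        congr 1
        exact (Classical.choose_spec (v + v').2).unique
          ((Classical.choose_spec v.2).add (Classical.choose_spec v'.2))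
      map_smul' := by
        intro c v
        rw [RingHom.id_apply, smul_comm]
        congr 1
        exact (Classical.choose_spec (c • v).2).unique ((Classical.choose_spec v.2).smul c) }

/-- The harmonic oscillator operator `(Q² + P²) / 2`, with domain `D(Q²) ∩ D(P²)`. -/
def oscillatorOp : L2R →ₗ.[ℂ] L2R :=
  (1 / 2 : ℂ) • (opMul positionOp positionOp + opMul momentumOp momentumOp)

end

noncomputable section

open Filter Topology

/-! ### One-parameter unitary groups and their generators -/

section Abstract

variable {H : Type*} [NormedAddCommGroup H] [InnerProductSpace ℂ H]

/-! The representation is built from its action on the coherent vectors `coh z`, the functions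
exp(zx - x²/2 - z²/4). Their Gram matrix is √π exp(z̄w/2) (`inner_coh`), and they are total, because
testing against imaginary labels is a Fourier transform (`eq_zero_of_inner_coh_eq_zero`). An element
g moves labels by the affine map z ↦ `phase` · z + `shift` and multiplies by exp(`factor`). This
preserves the Gram matrix (`inner_actCoh`) and `factor` is an additive cocycle (`factor_mul`), so
the action extends to unitary operators forming a representation. No integral kernel is needed.

Irreducibility: `coh 0` is a rotation eigenvector, and every vector a with the same eigenvalues is a
multiple of it, since ⟨a, coh z⟩ is entire and rotation invariant in z, hence constant
(`eq_smul_coh_zero`). Projecting `coh 0` onto a closed invariant subspace W therefore puts it in W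
or in Wᗮ, and translations then produce all coherent vectors.

Generators, domains included: `IsUnitaryGroup.generator_eq`. A dense subspace S of the domain that
is invariant under the group is a core. If B agrees with the generator on S, then closedness of B
along sequences in S gives generator ⊆ B, and symmetry of B against S gives B ⊆ generator;
self-adjointness of B is never needed beforehand. Here S is the span of the coherent vectors, where
each generator is found by differentiating an explicit curve (`hasDerivAt_exp_smul_coh`). Only for
the oscillator is closedness an issue, as a sum of closed operators need not be closed. There the
commutation relation yields ‖Q²f‖² + ‖P²f‖² ≤ ‖(Q² + P²)f‖² + 2‖f‖² (`norm_sq_add_norm_sq_le`), so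
Q² and P² converge separately, and the domain is exactly D(Q²) ∩ D(P²). -/

/-- Strongly continuous one-parameter groups of isometries. -/
structure IsUnitaryGroup (U : ℝ → H →L[ℂ] H) : Prop where
  zero : U 0 = 1
  add : ∀ s t v, U (s + t) v = U s (U t v)
  inner_map : ∀ t v w, inner ℂ (U t v) (U t w) = inner ℂ v w
  continuous_apply : ∀ v, Continuous fun t => U t v

theorem mem_generator_graph {U : ℝ → H →L[ℂ] H} {v w : H} :
    (v, w) ∈ (generator U).graph ↔ HasDerivAt (fun t => U t v) (-Complex.I • w) 0 := by
  rw [LinearPMap.mem_graph_iff]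
  constructor
  · rintro ⟨⟨y, hy⟩, rfl, h⟩
    have hy' : DifferentiableAt ℝ (fun t => U t y) 0 := hy
    have h' : Complex.I • deriv (fun t => U t y) 0 = w := h
    have := hy'.hasDerivAt
    rw [← h', smul_smul]
    simpa using this
  · intro h
    refine ⟨⟨v, h.differentiableAt⟩, rfl, ?_⟩
    change Complex.I • deriv (fun t => U t v) 0 = w
    rw [h.deriv, smul_smul]
    simp

/-- If only zero in a closed subspace `L` of `H × H` is orthogonal to `K ≤ L`, then `K` is dense
in `L`. -/
theorem Submodule.exists_seq_tendsto_of_orthogonal [CompleteSpace H] {K L : Submodule ℂ (H × H)}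
    (hKL : K ≤ L) (hL : IsClosed (L : Set (H × H)))
    (h : ∀ p ∈ L, (∀ q ∈ K, inner ℂ q.1 p.1 + inner ℂ q.2 p.2 = 0) → p = 0)
    {p : H × H} (hp : p ∈ L) :
    ∃ q : ℕ → H × H, (∀ n, q n ∈ K) ∧ Tendsto q atTop (𝓝 p) := by
  -- `H × H` carries the sup norm; the orthogonal projection is taken in the Hilbert sum `WithLp 2`,
  -- which has the same topology.
  let e := WithLp.prodContinuousLinearEquiv 2 ℂ H H
  let K' : Submodule ℂ (WithLp 2 (H × H)) := (K.comap (e : WithLp 2 (H × H) →ₗ[ℂ] H × H))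
  let M := K'.topologicalClosure
  have hM : IsClosed (M : Set (WithLp 2 (H × H))) := K'.isClosed_topologicalClosure
  have : CompleteSpace M := hM.completeSpace_coe
  have hML : ∀ x ∈ M, e x ∈ L := by
    intro x hx
    have hc : IsClosed (e ⁻¹' (L : Set (H × H))) := hL.preimage e.continuous
    exact closure_minimal (s := (K' : Set (WithLp 2 (H × H)))) (fun y hy => hKL hy) hc hx
  obtain ⟨x, hx, y, hy, hxy⟩ := M.exists_add_mem_mem_orthogonal (e.symm p)
  have hy0 : e y = 0 := by
    apply h
    · have : e y = p - e x := by
        rw [← e.apply_symm_apply p, hxy, map_add]; abel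
      rw [this]
      exact L.sub_mem hp (hML x hx)
    · intro q hq
      have hq' : e.symm q ∈ M := K'.le_topologicalClosure (by simpa [K'] using hq)
      have := (M.mem_orthogonal y).1 hy _ hq'
      simpa [WithLp.prod_inner_apply, e] using this
  have hy1 : y = 0 := by simpa using hy0
  have hxM : e.symm p ∈ closure (K' : Set (WithLp 2 (H × H))) := by
    rw [hxy, hy1, add_zero]; exact hx
  obtain ⟨q, hq, hqp⟩ := mem_closure_iff_seq_limit.1 hxM
  refine ⟨fun n => e (q n), fun n => hq n, ?_⟩
  simpa [Function.comp_def] using (e.continuous.tendsto _).comp hqp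

namespace IsUnitaryGroup

variable {U : ℝ → H →L[ℂ] H} (hU : IsUnitaryGroup U)
include hU

theorem apply_neg_apply (t : ℝ) (v : H) : U t (U (-t) v) = v := by
  rw [← hU.add, add_neg_cancel, hU.zero]; rfl

theorem inner_map_left (t : ℝ) (v w : H) : inner ℂ v (U t w) = inner ℂ (U (-t) v) w := by
  conv_lhs => rw [← hU.apply_neg_apply t v]
  rw [hU.inner_map]

theorem hasDerivAt {v w : H} (h : (v, w) ∈ (generator U).graph) (t : ℝ) :
    HasDerivAt (fun s => U s v) (-Complex.I • U t w) t := by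
  rw [mem_generator_graph] at h
  have h0 : HasDerivAt (fun s => U s v) (-Complex.I • w) (-t + t) := by simpa using h
  have h1 : HasDerivAt (fun s => U (-t + s) v) (-Complex.I • w) t := h0.comp_const_add (-t) t
  have h2 := ((U t).restrictScalars ℝ).hasFDerivAt.comp_hasDerivAt t h1
  have e : (((U t).restrictScalars ℝ) ∘ fun s => U (-t + s) v) = fun s => U s v := by
    ext s
    simp [← hU.add]
  rw [e] at h2
  simpa using h2

theorem apply_mem_graph {v w : H} (h : (v, w) ∈ (generator U).graph) (t : ℝ) :
    (U t v, U t w) ∈ (generator U).graph := by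
  rw [mem_generator_graph]
  have h1 := hU.hasDerivAt h (0 + t)
  have h2 := h1.comp_add_const 0 t
  simp only [zero_add] at h2
  simpa only [hU.add] using h2

/-- Differentiate the constant function t ↦ ⟨U t v, U t v'⟩ at 0. -/
theorem symmetric {v w v' w' : H} (h : (v, w) ∈ (generator U).graph)
    (h' : (v', w') ∈ (generator U).graph) : inner ℂ w v' = inner ℂ v w' := by
  rw [mem_generator_graph] at h h'
  have h1 := h.inner ℂ h'
  have e : (fun t => inner ℂ (U t v) (U t v')) = fun _ => inner ℂ v v' := by
    ext t; exact hU.inner_map t v v'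
  rw [e] at h1
  have h2 := h1.unique (hasDerivAt_const _ _)
  simp only [hU.zero, one_apply_eq_self, inner_smul_left, inner_smul_right, map_neg,
    Complex.conj_I, neg_neg] at h2
  have h3 : Complex.I * (inner ℂ w v' - inner ℂ v w') = 0 := by linear_combination h2
  rcases mul_eq_zero.1 h3 with h4 | h4
  · exact absurd h4 Complex.I_ne_zero
  · exact sub_eq_zero.1 h4

/-- A vector at which the generator is weakly defined, against an invariant dense set of vectors of
its domain, is in its domain. -/
theorem mem_graph_of_weak [CompleteSpace H] {S : Set H} (hS : Dense S)
    (hinv : ∀ v ∈ S, ∀ t, U t v ∈ S)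
    {v w : H} (h : ∀ g ∈ S, ∃ g', (g, g') ∈ (generator U).graph ∧ inner ℂ g' v = inner ℂ g w) :
    (v, w) ∈ (generator U).graph := by
  have hc : Continuous fun t => -Complex.I • U t w := (hU.continuous_apply w).const_smul _
  have key : ∀ g ∈ S, ∀ t, HasDerivAt (fun t => inner ℂ g (U t v))
      (inner ℂ g (-Complex.I • U t w)) t := by
    intro g hg t
    -- Moving U t to the left factor turns g into U (-t) g, which is again in S; hence the weak
    -- relation is available at every time and not only at 0.
    obtain ⟨g', hg', hgw⟩ := h _ (hinv g hg (-t))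
    obtain ⟨g1, hg1, -⟩ := h _ hg
    have hg2 := LinearPMap.mem_graph_snd_inj _ hg' (hU.apply_mem_graph hg1 (-t)) rfl
    have h1 := (hU.hasDerivAt hg1 (-t)).scomp t (hasDerivAt_neg t)
    have h2 := h1.inner ℂ (hasDerivAt_const t v)
    have e : (fun t => inner ℂ g (U t v)) = fun t => inner ℂ (((fun s => U s g) ∘ Neg.neg) t) v := by
      ext s
      exact hU.inner_map_left s g v
    rw [e]
    refine h2.congr_deriv ?_
    rw [← hg2]
    simp only [inner_zero_right, zero_add, neg_smul, one_smul, neg_neg, inner_smul_left,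
      Complex.conj_I, hgw, inner_smul_right, inner_neg_right, hU.inner_map_left]
    ring
  -- The weak differential equation integrates to a strong identity because S is dense, and its
  -- right side is differentiable in norm.
  have key2 : ∀ t, U t v = v + ∫ s in (0 : ℝ)..t, -Complex.I • U s w := by
    intro t
    rw [← sub_eq_zero]
    refine hS.eq_zero_of_inner_right ℂ fun g hg => ?_
    have hd : ∀ t, HasDerivAt (fun t => inner ℂ g
        (U t v - (v + ∫ s in (0 : ℝ)..t, -Complex.I • U s w))) 0 t := by
      intro t
      simp only [inner_sub_right, inner_add_right]
      have h1 := (hc.integral_hasStrictDerivAt 0 t).hasDerivAt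
      have h2 := (hasDerivAt_const t g).inner ℂ h1
      have h3 := (key g hg t).sub (h2.const_add (inner ℂ g v))
      exact h3.congr_deriv (by simp)
    have hd' := is_const_of_deriv_eq_zero (fun t => (hd t).differentiableAt)
      (fun t => (hd t).deriv) t 0
    rw [hd']
    simp [hU.zero]
  rw [mem_generator_graph]
  have h1 := ((hc.integral_hasStrictDerivAt 0 0).hasDerivAt).const_add v
  simp only [← key2] at h1
  simpa [hU.zero] using h1

/-- The symmetry relation against the domain passes to limits, so a limit of graph points satisfies
the weak criterion with S the domain itself. -/
theorem isClosed_graph [CompleteSpace H] (hd : Dense ((generator U).domain : Set H)) :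
    IsClosed ((generator U).graph : Set (H × H)) := by
  refine isClosed_of_closure_subset fun p hp => ?_
  obtain ⟨q, hq, hqp⟩ := mem_closure_iff_seq_limit.1 hp
  have h1 : Tendsto (fun n => (q n).1) atTop (𝓝 p.1) := (continuous_fst.tendsto _).comp hqp
  have h2 : Tendsto (fun n => (q n).2) atTop (𝓝 p.2) := (continuous_snd.tendsto _).comp hqp
  refine hU.mem_graph_of_weak (S := (generator U).domain) hd ?_ ?_
  · intro v hv t
    obtain ⟨w, hw⟩ := LinearPMap.mem_domain_iff.1 hv
    exact LinearPMap.mem_domain_of_mem_graph (hU.apply_mem_graph hw t)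
  · intro g hg
    obtain ⟨g', hg'⟩ := LinearPMap.mem_domain_iff.1 hg
    refine ⟨g', hg', ?_⟩
    have h3 : Tendsto (fun n => inner ℂ g' (q n).1) atTop (𝓝 (inner ℂ g' p.1)) :=
      tendsto_const_nhds.inner h1
    have h4 : Tendsto (fun n => inner ℂ g (q n).2) atTop (𝓝 (inner ℂ g p.2)) :=
      tendsto_const_nhds.inner h2
    refine tendsto_nhds_unique h3 (h4.congr fun n => ?_)
    exact (hU.symmetric hg' (hq n)).symm

/-- Identification of the generator with an operator `B` that agrees with it on an invariant dense
subspace, is symmetric against it and closed on it. -/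
theorem generator_eq [CompleteSpace H] {B : H →ₗ.[ℂ] H} {S : Submodule ℂ H}
    (hS : Dense (S : Set H)) (hinv : ∀ v ∈ S, ∀ t, U t v ∈ S)
    (hB : ∀ v ∈ S, ∃ w, (v, w) ∈ B.graph ∧ (v, w) ∈ (generator U).graph)
    (hsymm : ∀ v ∈ S, ∀ w, (v, w) ∈ B.graph → ∀ v' w', (v', w') ∈ B.graph →
      inner ℂ w v' = inner ℂ v w')
    (hclosed : ∀ (v w : ℕ → H) (v₀ w₀ : H), (∀ n, v n ∈ S) → (∀ n, (v n, w n) ∈ B.graph) →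
      Tendsto v atTop (𝓝 v₀) → Tendsto w atTop (𝓝 w₀) → (v₀, w₀) ∈ B.graph) :
    generator U = B := by
  apply LinearPMap.eq_of_eq_graph
  apply le_antisymm
  · intro p hp
    let K : Submodule ℂ (H × H) := (generator U).graph ⊓ S.comap (LinearMap.fst ℂ H H)
    have hd : Dense ((generator U).domain : Set H) := hS.mono fun v hv => by
      obtain ⟨w, -, hw⟩ := hB v hv
      exact LinearPMap.mem_domain_of_mem_graph hw
    obtain ⟨q, hq, hqp⟩ := Submodule.exists_seq_tendsto_of_orthogonal
      (K := K) (L := (generator U).graph) inf_le_left (hU.isClosed_graph hd) (by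
        intro r hr horth
        -- Write A for the generator. A point (r₁, A r₁) orthogonal to the graph over S satisfies
        -- A(A r₁) = -r₁ weakly, hence strongly. Symmetry then gives ‖A r₁‖² = -‖r₁‖², so both
        -- vanish.
        have h1 : (r.2, -r.1) ∈ (generator U).graph := by
          refine hU.mem_graph_of_weak hS hinv fun g hg => ?_
          obtain ⟨g', -, hg'⟩ := hB g hg
          refine ⟨g', hg', ?_⟩
          have := horth (g, g') ⟨hg', hg⟩
          rw [inner_neg_right]
          exact eq_neg_of_add_eq_zero_right this
        have h2 := hU.symmetric hr h1
        rw [inner_neg_right] at h2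
        have h3 : (‖r.2‖ : ℝ) ^ 2 + ‖r.1‖ ^ 2 = 0 := by
          rw [← inner_self_eq_norm_sq (𝕜 := ℂ), ← inner_self_eq_norm_sq (𝕜 := ℂ), h2]
          simp
        have h4 : ‖r.2‖ = 0 := by nlinarith [sq_nonneg ‖r.2‖, sq_nonneg ‖r.1‖]
        have h5 : ‖r.1‖ = 0 := by nlinarith [sq_nonneg ‖r.2‖, sq_nonneg ‖r.1‖]
        exact Prod.ext (norm_eq_zero.1 h5) (norm_eq_zero.1 h4)) hp
    refine hclosed (fun n => (q n).1) (fun n => (q n).2) p.1 p.2 (fun n => (hq n).2) (fun n => ?_)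
      ((continuous_fst.tendsto _).comp hqp) ((continuous_snd.tendsto _).comp hqp)
    obtain ⟨w, hw, hw'⟩ := hB (q n).1 (hq n).2
    rwa [LinearPMap.mem_graph_snd_inj _ (hq n).1 hw' rfl]
  · rintro ⟨v, w⟩ hvw
    refine hU.mem_graph_of_weak hS hinv fun g hg => ?_
    obtain ⟨g', hg', hg''⟩ := hB g hg
    exact ⟨g', hg'', hsymm g hg g' hg' v w hvw⟩

end IsUnitaryGroup

end Abstract

/-! ### Polynomials times complex Gaussians -/

section Gaussian

open Polynomial
open scoped FourierTransform

/-- The function `p(x) exp (z x - x² / 2)`. -/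
def gaussFun (p : ℂ[X]) (z : ℂ) (x : ℝ) : ℂ :=
  p.eval (x : ℂ) * Complex.exp (z * x - x ^ 2 / 2)

theorem continuous_gaussFun (p : ℂ[X]) (z : ℂ) : Continuous (gaussFun p z) := by
  unfold gaussFun
  have := p.continuous.comp Complex.continuous_ofReal
  fun_prop

theorem norm_cexp_gauss (z : ℂ) (x : ℝ) :
    ‖Complex.exp (z * x - x ^ 2 / 2)‖ = Real.exp (z.re * x - x ^ 2 / 2) := by
  rw [Complex.norm_exp]
  congr 1
  have : (z * x - x ^ 2 / 2 : ℂ) = z * x - ((x ^ 2 / 2 : ℝ) : ℂ) := by push_cast; ring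
  rw [this, Complex.sub_re, Complex.re_mul_ofReal, Complex.ofReal_re]

theorem memLp_exp_gauss (a : ℝ) :
    MemLp (fun x : ℝ => Real.exp (a * x - x ^ 2 / 2)) 2 volume := by
  rw [memLp_two_iff_integrable_sq (Continuous.aestronglyMeasurable (by fun_prop))]
  have h := (integrable_cexp_quadratic (b := 1) (by simp) (2 * a) 0).norm
  refine h.congr (Eventually.of_forall fun x => ?_)
  have : (-1 * (x : ℂ) ^ 2 + 2 * a * x + 0) = ((2 * (a * x - x ^ 2 / 2) : ℝ) : ℂ) := by
    push_cast; ring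
  simp only [this]
  rw [← Complex.ofReal_exp, Complex.norm_real, Real.norm_of_nonneg (Real.exp_pos _).le, two_mul,
    Real.exp_add, ← sq]

/-- exp(n|x|) is one of exp(nx), exp(-nx), so two shifted Gaussians dominate. -/
theorem memLp_exp_abs_gauss (n a : ℝ) :
    MemLp (fun x : ℝ => Real.exp (n * |x|) * Real.exp (a * x - x ^ 2 / 2)) 2 volume := by
  refine ((memLp_exp_gauss (a + n)).add (memLp_exp_gauss (a - n))).mono
    (Continuous.aestronglyMeasurable (by fun_prop)) (Eventually.of_forall fun x => ?_)
  simp only [Pi.add_apply]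
  rw [Real.norm_of_nonneg (by positivity), Real.norm_of_nonneg (by positivity), ← Real.exp_add]
  rcases abs_cases x with ⟨h, -⟩ | ⟨h, -⟩ <;> rw [h]
  · refine le_trans (le_of_eq ?_) (le_add_of_nonneg_right (Real.exp_pos _).le)
    congr 1; ring
  · refine le_trans (le_of_eq ?_) (le_add_of_nonneg_left (Real.exp_pos _).le)
    congr 1; ring

theorem gaussFun_add (p q : ℂ[X]) (z : ℂ) : gaussFun (p + q) z = gaussFun p z + gaussFun q z := by
  ext x; simp [gaussFun, add_mul]

theorem gaussFun_smul (c : ℂ) (p : ℂ[X]) (z : ℂ) : gaussFun (c • p) z = c • gaussFun p z := by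
  ext x; simp [gaussFun, mul_assoc]

theorem memLp_gaussFun (p : ℂ[X]) (z : ℂ) : MemLp (gaussFun p z) 2 volume := by
  induction p using Polynomial.induction_on' with
  | add p q hp hq => rw [gaussFun_add]; exact hp.add hq
  | monomial n c =>
    refine ((memLp_exp_abs_gauss 1 z.re).const_mul (‖c‖ * n.factorial)).mono
      (continuous_gaussFun _ _).aestronglyMeasurable (Eventually.of_forall fun x => ?_)
    simp only [gaussFun, eval_monomial, norm_mul, norm_cexp_gauss, norm_pow, Complex.norm_real,
      Real.norm_eq_abs, Real.abs_exp, one_mul, abs_norm, Nat.abs_cast]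
    have h := Real.pow_div_factorial_le_exp |x| (abs_nonneg x) n
    rw [div_le_iff₀ (by positivity)] at h
    calc ‖c‖ * |x| ^ n * Real.exp (z.re * x - x ^ 2 / 2)
        ≤ ‖c‖ * (Real.exp |x| * n.factorial) * Real.exp (z.re * x - x ^ 2 / 2) := by gcongr
      _ = _ := by ring

/-- The vector `p(x) exp (z x - x² / 2)` of `L²(ℝ)`, linear in `p`. -/
def gaussVec (z : ℂ) : ℂ[X] →ₗ[ℂ] L2R where
  toFun p := (memLp_gaussFun p z).toLp
  map_add' p q := by
    rw [← MemLp.toLp_add]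
    exact MemLp.toLp_congr _ _ (by rw [gaussFun_add])
  map_smul' c p := by
    rw [RingHom.id_apply, ← MemLp.toLp_const_smul]
    exact MemLp.toLp_congr _ _ (by rw [gaussFun_smul])

theorem coeFn_gaussVec (z : ℂ) (p : ℂ[X]) : gaussVec z p =ᵐ[volume] gaussFun p z :=
  MemLp.coeFn_toLp (memLp_gaussFun p z)

theorem norm_cexp_sub_one_sub_le (w : ℂ) :
    ‖Complex.exp w - 1 - w‖ ≤ ‖w‖ ^ 2 * Real.exp ‖w‖ := by
  have := Complex.norm_exp_sub_sum_le_norm_mul_exp w 2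
  simpa [Finset.sum_range_succ, sub_sub] using this

/-- The derivative is taken in the L² norm. The bound |e^w - 1 - w| ≤ |w|² e^|w| at w = hx, together
with x² ≤ 2 e^|x|, gives for |h| ≤ 1 a remainder at most 2|h|² times a fixed L² function. -/
theorem hasDerivAt_gaussVec_one (z : ℂ) :
    HasDerivAt (fun z => gaussVec z 1) (gaussVec z X) z := by
  set G : L2R := (memLp_exp_abs_gauss 2 z.re).ofReal (K := ℂ).toLp with hG
  have bound : ∀ h : ℂ, ‖h‖ ≤ 1 →
      ‖gaussVec (z + h) 1 - gaussVec z 1 - h • gaussVec z X‖ ≤ (2 * ‖G‖) * ‖h‖ ^ 2 := by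
    intro h hh
    have key : ∀ᵐ x, ‖(gaussVec (z + h) 1 - gaussVec z 1 - h • gaussVec z X : L2R) x‖ ≤
        (2 * ‖h‖ ^ 2) * ‖G x‖ := by
      filter_upwards [Lp.coeFn_sub (gaussVec (z + h) 1 - gaussVec z 1) (h • gaussVec z X),
        Lp.coeFn_sub (gaussVec (z + h) 1) (gaussVec z 1), Lp.coeFn_smul h (gaussVec z X),
        coeFn_gaussVec (z + h) 1, coeFn_gaussVec z 1, coeFn_gaussVec z X,
        MemLp.coeFn_toLp ((memLp_exp_abs_gauss 2 z.re).ofReal (K := ℂ))]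
        with x h1 h2 h3 h4 h5 h6 h7
      rw [h1, Pi.sub_apply, h2, Pi.sub_apply, h3, Pi.smul_apply, h4, h5, h6, hG, h7]
      have e : gaussFun 1 (z + h) x - gaussFun 1 z x - h • gaussFun X z x
          = (Complex.exp (h * x) - 1 - h * x) * Complex.exp (z * x - x ^ 2 / 2) := by
        simp only [gaussFun, eval_one, eval_X, smul_eq_mul]
        rw [show (z + h) * (x : ℂ) - (x : ℂ) ^ 2 / 2 = h * x + (z * x - (x : ℂ) ^ 2 / 2) by ring,
          Complex.exp_add]
        ring
      rw [e, norm_mul, norm_cexp_gauss]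
      have h8 := norm_cexp_sub_one_sub_le (h * x)
      have h9 : ‖h * (x : ℂ)‖ = ‖h‖ * |x| := by simp
      have h10 : Real.exp (‖h‖ * |x|) ≤ Real.exp |x| :=
        Real.exp_le_exp.2 (mul_le_of_le_one_left (abs_nonneg x) hh)
      have h11 : |x| ^ 2 ≤ 2 * Real.exp |x| := by
        have := Real.pow_div_factorial_le_exp |x| (abs_nonneg x) 2
        rw [div_le_iff₀ (by positivity)] at this
        simpa [mul_comm] using this
      have h12 : ‖Complex.exp (h * x) - 1 - h * x‖ ≤ 2 * ‖h‖ ^ 2 * Real.exp (2 * |x|) := by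
        refine h8.trans ?_
        rw [h9, mul_pow]
        calc ‖h‖ ^ 2 * |x| ^ 2 * Real.exp (‖h‖ * |x|)
            ≤ ‖h‖ ^ 2 * (2 * Real.exp |x|) * Real.exp |x| := by gcongr
          _ = 2 * ‖h‖ ^ 2 * Real.exp (2 * |x|) := by rw [two_mul |x|, Real.exp_add]; ring
      have h13 : ‖(RCLike.ofReal (Real.exp (2 * |x|) * Real.exp (z.re * x - x ^ 2 / 2)) : ℂ)‖
          = Real.exp (2 * |x|) * Real.exp (z.re * x - x ^ 2 / 2) := by
        rw [RCLike.norm_ofReal, abs_of_nonneg (by positivity)]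
      rw [h13, ← mul_assoc]
      exact mul_le_mul_of_nonneg_right h12 (Real.exp_pos _).le
    refine (Lp.norm_le_mul_norm_of_ae_le_mul key).trans (le_of_eq (by ring))
  rw [hasDerivAt_iff_isLittleO_nhds_zero]
  have hO : (fun h : ℂ => gaussVec (z + h) 1 - gaussVec z 1 - h • gaussVec z X)
      =O[𝓝 0] fun h : ℂ => ‖h‖ ^ 2 := by
    refine Asymptotics.IsBigO.of_bound (2 * ‖G‖) ?_
    filter_upwards [Metric.closedBall_mem_nhds (0 : ℂ) one_pos] with h hh
    have := bound h (by simpa using hh)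
    simpa using this
  refine hO.trans_isLittleO ?_
  exact (Asymptotics.isLittleO_norm_pow_id (E' := ℂ) one_lt_two)

/-- The coherent vectors `exp (z x - x² / 2 - z² / 4)`. -/
def coh (z : ℂ) : L2R := Complex.exp (-z ^ 2 / 4) • gaussVec z 1

theorem hasDerivAt_coh (z : ℂ) :
    HasDerivAt coh (Complex.exp (-z ^ 2 / 4) • gaussVec z (X - C (z / 2))) z := by
  have h1 : HasDerivAt (fun z : ℂ => Complex.exp (-z ^ 2 / 4))
      (Complex.exp (-z ^ 2 / 4) * -(z / 2)) z := by
    refine HasDerivAt.cexp ?_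
    have := ((hasDerivAt_id z).pow 2).neg.div_const 4
    refine this.congr_deriv ?_
    simp; ring
  refine (h1.smul (hasDerivAt_gaussVec_one z)).congr_deriv ?_
  rw [← mul_one (C (z / 2)), ← smul_eq_C_mul, map_sub, map_smul, smul_sub, sub_eq_add_neg, mul_smul,
    ← smul_neg, ← neg_smul]

theorem continuous_coh : Continuous coh :=
  continuous_iff_continuousAt.2 fun z => (hasDerivAt_coh z).continuousAt

theorem inner_gaussVec_one (z w : ℂ) : inner ℂ (gaussVec z 1) (gaussVec w 1) =
    (Real.sqrt Real.pi : ℂ) * Complex.exp ((starRingEnd ℂ z + w) ^ 2 / 4) := by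
  rw [L2.inner_def]
  have : ∀ᵐ x : ℝ, inner ℂ (gaussVec z 1 x) (gaussVec w 1 x) =
      Complex.exp (-1 * x ^ 2 + (starRingEnd ℂ z + w) * x + 0) := by
    filter_upwards [coeFn_gaussVec z 1, coeFn_gaussVec w 1] with x h1 h2
    rw [h1, h2]
    simp only [gaussFun, eval_one, one_mul, RCLike.inner_apply, ← Complex.exp_conj,
      ← Complex.exp_add, map_sub, map_mul, map_div₀, map_pow, Complex.conj_ofReal]
    congr 1
    have : (starRingEnd ℂ) 2 = 2 := Complex.conj_ofNat 2
    rw [this]; ring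
  rw [integral_congr_ae this, integral_cexp_quadratic (by simp)]
  congr 1
  · rw [neg_neg, div_one, Real.sqrt_eq_rpow, Complex.ofReal_cpow Real.pi_pos.le]
    norm_num
  · congr 1; ring

/-- The factor exp(-z²/4) in `coh` removes the z̄² and w² terms of (z̄ + w)²/4, leaving the
reproducing kernel of Fock space. -/
theorem inner_coh (z w : ℂ) : inner ℂ (coh z) (coh w) =
    (Real.sqrt Real.pi : ℂ) * Complex.exp (starRingEnd ℂ z * w / 2) := by
  rw [coh, coh, inner_smul_left, inner_smul_right, inner_gaussVec_one, ← Complex.exp_conj]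
  rw [mul_left_comm (Complex.exp (-w ^ 2 / 4)), mul_left_comm, ← Complex.exp_add, ← Complex.exp_add]
  congr 2
  have : (starRingEnd ℂ) 4 = 4 := Complex.conj_ofNat 4
  simp only [map_div₀, map_neg, map_pow, this]
  ring

/-- A test function is the Fourier transform of a Schwartz function K, and the transform can be
moved from K to f under the integral. -/
theorem ae_eq_zero_of_fourier_eq_zero {f : ℝ → ℂ} (hf : Integrable f)
    (h : ∀ y : ℝ, ∫ x : ℝ, Complex.exp (-2 * Real.pi * Complex.I * y * x) * f x = 0) :
    f =ᵐ[volume] 0 := by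
  have h0 : ∀ y : ℝ, 𝓕 f y = 0 := by
    intro y
    rw [Real.fourier_real_eq_integral_exp_smul, ← h y]
    refine integral_congr_ae (Eventually.of_forall fun x => ?_)
    simp only [smul_eq_mul]
    congr 2
    push_cast; ring
  refine ae_eq_zero_of_integral_contDiff_smul_eq_zero hf.locallyIntegrable fun g hg hc => ?_
  let G : SchwartzMap ℝ ℂ := (hc.comp_left (g := ((↑) : ℝ → ℂ)) (by simp)).toSchwartzMap
    (Complex.ofRealCLM.contDiff.comp hg)
  have hG : ∀ x, G x = g x := fun x => rfl
  let K : SchwartzMap ℝ ℂ := 𝓕⁻ G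
  have h1 := VectorFourier.integral_fourierIntegral_smul_eq_flip (L := innerₗ ℝ)
    Real.continuous_fourierChar continuous_inner hf (K.integrable (μ := volume))
  have h2 : ∀ x, VectorFourier.fourierIntegral Real.fourierChar volume (innerₗ ℝ).flip K x
      = (g x : ℂ) := by
    intro x
    have hK : 𝓕 K = G := FourierTransform.fourier_fourierInv_eq G
    rw [flip_innerₗ, ← hG, ← hK]
    rfl
  have h3 : ∀ x, VectorFourier.fourierIntegral Real.fourierChar volume (innerₗ ℝ) f x = 0 := h0
  simp only [h2, h3, zero_smul, integral_zero] at h1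
  rw [h1]
  refine integral_congr_ae (Eventually.of_forall fun x => ?_)
  simp [mul_comm]

/-- At the label 2πiy the inner product is the Fourier transform of exp(-x²/2) v(x) at y, and the
Gaussian never vanishes. -/
theorem eq_zero_of_inner_coh_eq_zero {v : L2R} (h : ∀ z, inner ℂ (coh z) v = 0) : v = 0 := by
  have h0 : ∀ z, inner ℂ (gaussVec z 1) v = 0 := fun z => by
    have := h z
    rw [coh, inner_smul_left] at this
    exact (mul_eq_zero.1 this).resolve_left (by simp)
  have hf : Integrable (fun x => gaussFun 1 0 x * v x) :=
    (memLp_gaussFun 1 0).integrable_mul (Lp.memLp v)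
  have h1 := ae_eq_zero_of_fourier_eq_zero hf fun y => by
    refine Eq.trans ?_ (h0 (2 * Real.pi * y * Complex.I))
    rw [L2.inner_def]
    refine integral_congr_ae ?_
    filter_upwards [coeFn_gaussVec (2 * Real.pi * y * Complex.I) 1] with x hx
    rw [hx]
    simp only [gaussFun, Polynomial.eval_one, one_mul, RCLike.inner_apply, ← Complex.exp_conj,
      map_sub, map_mul, map_div₀, map_pow, Complex.conj_ofReal, Complex.conj_I]
    have : (starRingEnd ℂ) 2 = 2 := Complex.conj_ofNat 2
    rw [this, ← mul_assoc, ← Complex.exp_add, mul_comm (v x)]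
    congr 2
    ring
  apply Lp.ext
  filter_upwards [h1, Lp.coeFn_zero ℂ 2 (volume : Measure ℝ)] with x hx hx0
  rw [hx0]
  refine (mul_eq_zero.1 hx).resolve_left ?_
  simp [gaussFun]

/-- The span of the coherent vectors. -/
def cohSpan : Submodule ℂ L2R := Submodule.span ℂ (Set.range coh)

theorem coh_mem_cohSpan (z : ℂ) : coh z ∈ cohSpan := Submodule.subset_span ⟨z, rfl⟩

theorem dense_cohSpan : Dense (cohSpan : Set L2R) := by
  rw [Submodule.dense_iff_topologicalClosure_eq_top, Submodule.topologicalClosure_eq_top_iff,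
    Submodule.eq_bot_iff]
  intro v hv
  exact eq_zero_of_inner_coh_eq_zero fun z => (Submodule.mem_orthogonal _ _).1 hv _
    (coh_mem_cohSpan z)

end Gaussian

/-! ### Isometries from families of vectors -/

section Extension

variable {H : Type*} [NormedAddCommGroup H] [InnerProductSpace ℂ H]

/-- Equal Gram matrices give equal norms to corresponding finite combinations, so v i ↦ v' i is well
defined and isometric on the span. -/
theorem exists_isometry_of_inner_eq [CompleteSpace H] {ι : Type*} {v v' : ι → H}
    (hv : Dense (Submodule.span ℂ (Set.range v) : Set H))
    (h : ∀ i j, inner ℂ (v' i) (v' j) = inner ℂ (v i) (v j)) :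
    ∃ U : H →L[ℂ] H, (∀ i, U (v i) = v' i) ∧ ∀ x y, inner ℂ (U x) (U y) = inner ℂ x y := by
  let e := Finsupp.linearCombination ℂ v
  let f := Finsupp.linearCombination ℂ v'
  have he : DenseRange e := by
    rw [← Finsupp.range_linearCombination] at hv
    exact hv
  have hin : ∀ x y, inner ℂ (f x) (f y) = inner ℂ (e x) (e y) := by
    intro x y
    simp only [e, f, Finsupp.linearCombination_apply, Finsupp.sum, sum_inner, inner_sum,
      inner_smul_left, inner_smul_right, h]
  have hn : ∀ x, ‖f x‖ ≤ 1 * ‖e x‖ := fun x => by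
    rw [one_mul, ← sq_le_sq₀ (norm_nonneg _) (norm_nonneg _), ← inner_self_eq_norm_sq (𝕜 := ℂ),
      ← inner_self_eq_norm_sq (𝕜 := ℂ), hin]
  have hU : ∀ x, f.extendOfNorm e (e x) = f x := LinearMap.extendOfNorm_eq he ⟨1, hn⟩
  refine ⟨f.extendOfNorm e, fun i => ?_, fun x y => ?_⟩
  · simpa [e, f] using hU (Finsupp.single i 1)
  · refine he.induction_on₂ (p := fun x y => inner ℂ (f.extendOfNorm e x) (f.extendOfNorm e y) =
      inner ℂ x y) ?_ ?_ x y
    · exact isClosed_eq (by fun_prop) (by fun_prop)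
    · intro a b
      rw [hU, hU, hin]

theorem continuous_apply_of_dense {X : Type*} [TopologicalSpace X] {U : X → H →L[ℂ] H}
    (hU : ∀ x v, ‖U x v‖ = ‖v‖) {s : Set H} (hs : Dense (Submodule.span ℂ s : Set H))
    (h : ∀ v ∈ s, Continuous fun x => U x v) (v : H) : Continuous fun x => U x v := by
  have hspan : ∀ w ∈ Submodule.span ℂ s, Continuous fun x => U x w := by
    intro w hw
    induction hw using Submodule.span_induction with
    | mem w hw => exact h w hw
    | zero => simpa using continuous_const
    | add a b _ _ ha hb => simp only [map_add]; exact ha.add hb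
    | smul c a _ ha => simp only [map_smul]; exact ha.const_smul c
  refine continuous_of_uniform_approx_of_continuous fun u hu => ?_
  obtain ⟨ε, hε, hεu⟩ := Metric.mem_uniformity_dist.1 hu
  obtain ⟨w, hw, hwv⟩ := hs.exists_dist_lt v hε
  refine ⟨fun x => U x w, hspan w hw, fun x => hεu ?_⟩
  rwa [dist_eq_norm, ← map_sub, hU, ← dist_eq_norm]

theorem mem_unitary_of_inner_map [CompleteSpace H] {U V : H →L[ℂ] H}
    (hU : ∀ x y, inner ℂ (U x) (U y) = inner ℂ x y) (hUV : U * V = 1) :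
    U ∈ unitary (H →L[ℂ] H) := by
  have h1 : star U * U = 1 := by
    ext x
    refine ext_inner_left ℂ fun y => ?_
    rw [mul_apply_eq_comp, ContinuousLinearMap.star_eq_adjoint,
      ContinuousLinearMap.adjoint_inner_right, hU]
    rfl
  refine ⟨h1, ?_⟩
  have h2 : star U = V := by
    rw [← mul_one (star U), ← hUV, ← mul_assoc, h1, one_mul]
  rw [h2, hUV]

end Extension

/-! ### The representation, on coherent vectors -/

namespace EBar

variable (μ : ℝ)

/-- The phase by which the rotation by `φ` acts on the labels of the coherent vectors. -/
def phase (φ : ℝ) : ℂ := Complex.exp ((Real.sign μ * φ : ℝ) * Complex.I)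

/-- The displacement of the labels of the coherent vectors by the translation `(x, y)`. -/
def shift (x y : ℝ) : ℂ := Real.sqrt |μ| * (Real.sign μ * y - Complex.I * x)

/-- The logarithm of the factor with which `g` acts on the coherent vector of label `z`. -/
def factor (g : EBar) (z : ℂ) : ℂ :=
  -Complex.I * μ * g.s - shift μ g.ax g.ay * starRingEnd ℂ (shift μ g.ax g.ay) / 4
    - phase μ g.φ * z * starRingEnd ℂ (shift μ g.ax g.ay) / 2 + Complex.I * (Real.sign μ * g.φ) / 2

/-- The image of the coherent vector of label `z` under `g`. -/
def actCoh (g : EBar) (z : ℂ) : L2R :=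
  Complex.exp (factor μ g z) • coh (phase μ g.φ * z + shift μ g.ax g.ay)

variable {μ}

theorem phase_add (φ ψ : ℝ) : phase μ (φ + ψ) = phase μ φ * phase μ ψ := by
  rw [phase, phase, phase, ← Complex.exp_add]
  congr 1; push_cast; ring

theorem phase_zero : phase μ 0 = 1 := by simp [phase]

theorem phase_mul_conj (φ : ℝ) : phase μ φ * starRingEnd ℂ (phase μ φ) = 1 := by
  rw [phase, ← Complex.exp_conj, ← Complex.exp_add]
  simp

theorem phase_eq (hμ : μ ≠ 0) (φ : ℝ) :
    phase μ φ = Real.cos φ + Real.sign μ * Real.sin φ * Complex.I := by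
  rw [phase, Complex.exp_mul_I, ← Complex.ofReal_cos, ← Complex.ofReal_sin]
  rcases hμ.lt_or_gt with h | h
  · simp [Real.sign_of_neg h]
  · simp [Real.sign_of_pos h]

theorem sign_sq (hμ : μ ≠ 0) : ((Real.sign μ : ℝ) : ℂ) ^ 2 = 1 := by
  rcases hμ.lt_or_gt with h | h
  · simp [Real.sign_of_neg h]
  · simp [Real.sign_of_pos h]

theorem sqrt_sq_mul_sign : ((Real.sqrt |μ| : ℝ) : ℂ) ^ 2 * Real.sign μ = μ := by
  rw [← Complex.ofReal_pow, Real.sq_sqrt (abs_nonneg μ), ← Complex.ofReal_mul, mul_comm]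
  rcases lt_trichotomy μ 0 with h | h | h
  · simp [Real.sign_of_neg h, abs_of_neg h]
  · simp [h]
  · simp [Real.sign_of_pos h, abs_of_pos h]

/-- Up to the factor -i√|μ|, the shift is x + iy for μ > 0 and x - iy for μ < 0. A rotation by φ
thus multiplies it by exp(iφ) or exp(-iφ); this is why `phase` contains the sign of μ. -/
theorem phase_mul_shift (hμ : μ ≠ 0) (φ x y : ℝ) :
    phase μ φ * shift μ x y = shift μ (rotX φ x y) (rotY φ x y) := by
  rw [phase_eq hμ, shift, shift, rotX, rotY]
  simp only [Complex.ofReal_add, Complex.ofReal_sub, Complex.ofReal_mul]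
  linear_combination (-(Real.sqrt |μ| : ℂ) * Real.sin φ * x * Real.sign μ) * Complex.I_sq
    + (Real.sqrt |μ| : ℂ) * Complex.I * Real.sin φ * y * sign_sq hμ

/-- The area form of the plane appears as the imaginary part of the Hermitian product of labels,
with coefficient μ: this is where the central charge enters. -/
theorem conj_shift_mul_shift (x y x' y' : ℝ) :
    starRingEnd ℂ (shift μ x' y') * shift μ x y - shift μ x' y' * starRingEnd ℂ (shift μ x y)
      = -2 * Complex.I * μ * (x * y' - y * x') := by
  have h2 : (starRingEnd ℂ) 2 = 2 := Complex.conj_ofNat 2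
  simp only [shift, map_mul, map_sub, Complex.conj_ofReal, Complex.conj_I]
  linear_combination (-2 * Complex.I * (x * y' - y * x')) * sqrt_sq_mul_sign (μ := μ)

theorem shift_add (x y x' y' : ℝ) : shift μ (x + x') (y + y') = shift μ x y + shift μ x' y' := by
  simp only [shift]; push_cast; ring

/-- The cross terms of |shift|²/4 fail to match by an antisymmetric part, which is cancelled by the
central coordinate ½ a × R_φ a' through `conj_shift_mul_shift`. -/
theorem factor_mul (hμ : μ ≠ 0) (g h : EBar) (z : ℂ) : factor μ (g * h) z =
    factor μ h z + factor μ g (phase μ h.φ * z + shift μ h.ax h.ay) := by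
  simp only [factor, mul_def, shift_add, ← phase_mul_shift hμ, phase_add, map_add, map_mul]
  have h1 := phase_mul_conj (μ := μ) g.φ
  have h2 := conj_shift_mul_shift (μ := μ) g.ax g.ay (rotX g.φ h.ax h.ay) (rotY g.φ h.ax h.ay)
  rw [← phase_mul_shift hμ, map_mul] at h2
  push_cast
  linear_combination (-(shift μ h.ax h.ay * starRingEnd ℂ (shift μ h.ax h.ay)) / 4
    - phase μ h.φ * z * starRingEnd ℂ (shift μ h.ax h.ay) / 2) * h1 - h2 / 4

theorem inner_actCoh (g : EBar) (z w : ℂ) :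
    inner ℂ (actCoh μ g z) (actCoh μ g w) = inner ℂ (coh z) (coh w) := by
  rw [actCoh, actCoh, inner_smul_left, inner_smul_right, inner_coh, inner_coh,
    mul_left_comm (Complex.exp _), mul_left_comm, ← Complex.exp_conj, ← Complex.exp_add,
    ← Complex.exp_add]
  congr 2
  have h1 := phase_mul_conj (μ := μ) g.φ
  have h2 : (starRingEnd ℂ) 2 = 2 := Complex.conj_ofNat 2
  have h4 : (starRingEnd ℂ) 4 = 4 := Complex.conj_ofNat 4
  simp only [factor, map_add, map_sub, map_mul, map_neg, map_div₀, Complex.conj_I,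
    Complex.conj_ofReal, Complex.conj_conj, h2, h4]
  linear_combination (starRingEnd ℂ z * w / 2) * h1

variable (μ) in
/-- The operators of the representation. -/
def repOp (g : EBar) : L2R →L[ℂ] L2R :=
  Classical.choose (exists_isometry_of_inner_eq dense_cohSpan (inner_actCoh (μ := μ) g))

theorem repOp_coh (g : EBar) (z : ℂ) : repOp μ g (coh z) = actCoh μ g z :=
  (Classical.choose_spec (exists_isometry_of_inner_eq dense_cohSpan (inner_actCoh (μ := μ) g))).1 z

theorem inner_repOp (g : EBar) (v w : L2R) :
    inner ℂ (repOp μ g v) (repOp μ g w) = inner ℂ v w :=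
  (Classical.choose_spec
    (exists_isometry_of_inner_eq dense_cohSpan (inner_actCoh (μ := μ) g))).2 v w

theorem ext_coh {A B : L2R →L[ℂ] L2R} (h : ∀ z, A (coh z) = B (coh z)) : A = B :=
  ContinuousLinearMap.ext_on dense_cohSpan (by rintro _ ⟨z, rfl⟩; exact h z)

theorem repOp_one : repOp μ 1 = 1 := by
  refine ext_coh fun z => ?_
  rw [repOp_coh, actCoh]
  simp [factor, one_def, shift, phase_zero]

theorem repOp_mul (hμ : μ ≠ 0) (g h : EBar) : repOp μ (g * h) = repOp μ g * repOp μ h := by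
  refine ext_coh fun z => ?_
  rw [mul_apply_eq_comp, repOp_coh, repOp_coh, actCoh, actCoh, map_smul, repOp_coh,
    actCoh, smul_smul, ← Complex.exp_add, factor_mul hμ]
  congr 2
  simp only [mul_def, shift_add, ← phase_mul_shift hμ, phase_add]
  ring

theorem norm_repOp (g : EBar) (v : L2R) : ‖repOp μ g v‖ = ‖v‖ := by
  rw [← sq_eq_sq₀ (norm_nonneg _) (norm_nonneg _), ← inner_self_eq_norm_sq (𝕜 := ℂ),
    ← inner_self_eq_norm_sq (𝕜 := ℂ), inner_repOp]

theorem continuous_repOp (v : L2R) : Continuous fun g => repOp μ g v := by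
  refine continuous_apply_of_dense norm_repOp dense_cohSpan ?_ v
  rintro _ ⟨z, rfl⟩
  simp only [repOp_coh, actCoh, factor, phase, shift]
  have h1 := continuous_s
  have h2 := continuous_ax
  have h3 := continuous_ay
  have h4 := continuous_angle
  have h5 := continuous_coh
  fun_prop

/-- The representation of `Ē(2)` on `L²(ℝ)` with central charge `μ`. -/
def rep (hμ : μ ≠ 0) : UnitaryRep EBar L2R where
  toHom :=
    { toFun := fun g => ⟨repOp μ g, mem_unitary_of_inner_map (V := repOp μ g⁻¹) (inner_repOp g)
        (by rw [← repOp_mul hμ, mul_inv_cancel, repOp_one])⟩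
      map_one' := Subtype.ext repOp_one
      map_mul' := fun g h => Subtype.ext (repOp_mul hμ g h) }
  continuous_apply := continuous_repOp

theorem rep_op (hμ : μ ≠ 0) (g : EBar) : (rep hμ).op g = repOp μ g := rfl

/-! ### Irreducibility -/

/-- Differentiating in θ at 0 gives i z F'(z) = 0, so F' vanishes off 0 and, by continuity,
everywhere. -/
theorem const_of_rotation_invariant {F : ℂ → ℂ} (hF : Differentiable ℂ F)
    (h : ∀ (θ : ℝ) z, F (Complex.exp (θ * Complex.I) * z) = F z) (z : ℂ) : F z = F 0 := by
  have h1 : ∀ z, z * deriv F z = 0 := by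
    intro z
    have h2 : HasDerivAt (fun θ : ℝ => Complex.exp (θ * Complex.I) * z) (Complex.I * z) 0 := by
      have h3 : HasDerivAt (fun θ : ℝ => Complex.exp (θ * Complex.I)) _ (0 : ℝ) :=
        (Complex.ofRealCLM.hasDerivAt.mul_const Complex.I).cexp
      exact (h3.mul_const z).congr_deriv (by simp)
    have h4 : HasDerivAt F (deriv F z) (Complex.exp ((0 : ℝ) * Complex.I) * z) := by
      simpa using (hF z).hasDerivAt
    have h5 := h4.comp (0 : ℝ) h2
    have h6 : (F ∘ fun θ : ℝ => Complex.exp (θ * Complex.I) * z) = fun _ => F z := by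
      ext θ; exact h θ z
    rw [h6] at h5
    have h7 := h5.unique (hasDerivAt_const _ _)
    have h8 : Complex.I * (z * deriv F z) = 0 := by linear_combination h7
    exact (mul_eq_zero.1 h8).resolve_left Complex.I_ne_zero
  have h2 : deriv F = fun _ => 0 := by
    refine Continuous.ext_on (dense_compl_singleton (0 : ℂ))
      ((hF.contDiff (n := 1)).continuous_deriv le_rfl) continuous_const ?_
    intro z hz
    exact (mul_eq_zero.1 (h1 z)).resolve_left hz
  exact is_const_of_deriv_eq_zero hF (fun z => congrFun h2 z) z 0

/-- The half in the exponent is the ground state energy of the oscillator. It is single valued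
because φ ranges over ℝ. -/
theorem repOp_expJ_coh (φ : ℝ) (z : ℂ) : repOp μ (expJ φ) (coh z) =
    Complex.exp (Complex.I * (Real.sign μ * φ) / 2) • coh (phase μ φ * z) := by
  rw [repOp_coh, actCoh]
  simp [factor, expJ, shift]

/-- F(z) = ⟨a, coh z⟩ is entire and rotation invariant, hence constant, and ⟨coh 0, coh z⟩ is the
constant √π. A suitable multiple of `coh 0` has the same products with all coherent vectors as a. -/
theorem eq_smul_coh_zero (hμ : μ ≠ 0) {a : L2R}
    (h : ∀ φ, repOp μ (expJ φ) a = Complex.exp (Complex.I * (Real.sign μ * φ) / 2) • a) :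
    ∃ c : ℂ, a = c • coh 0 := by
  let F : ℂ → ℂ := fun z => inner ℂ a (coh z)
  have hF : Differentiable ℂ F := fun z =>
    ((innerSL ℂ a).hasFDerivAt.comp_hasDerivAt z (hasDerivAt_coh z)).differentiableAt
  have hrot : ∀ (φ : ℝ) z, F (phase μ φ * z) = F z := by
    intro φ z
    have h1 := inner_repOp (μ := μ) (expJ φ) a (coh z)
    rw [h, repOp_expJ_coh, inner_smul_left, inner_smul_right, ← Complex.exp_conj, ← mul_assoc,
      ← Complex.exp_add] at h1
    have h2 : (starRingEnd ℂ) 2 = 2 := Complex.conj_ofNat 2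
    have h3 : (starRingEnd ℂ) (Complex.I * (Real.sign μ * φ) / 2) +
        Complex.I * (Real.sign μ * φ) / 2 = 0 := by
      simp only [map_div₀, map_mul, Complex.conj_I, Complex.conj_ofReal, h2]; ring
    rwa [h3, Complex.exp_zero, one_mul] at h1
  have hconst := const_of_rotation_invariant hF (fun θ z => by
    rw [← hrot (Real.sign μ * θ) z, phase, ← mul_assoc]
    congr 5
    rcases hμ.lt_or_gt with h | h
    · simp [Real.sign_of_neg h]
    · simp [Real.sign_of_pos h])
  refine ⟨starRingEnd ℂ (F 0) / Real.sqrt Real.pi, ?_⟩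
  rw [← sub_eq_zero]
  refine eq_zero_of_inner_coh_eq_zero fun z => ?_
  rw [inner_sub_right, inner_smul_right, inner_coh, mul_zero, zero_div, Complex.exp_zero, mul_one,
    div_mul_cancel₀ _ (Complex.ofReal_ne_zero.2 (Real.sqrt_pos.2 Real.pi_pos).ne'),
    ← inner_conj_symm, sub_eq_zero]
  exact congrArg _ (hconst z)

theorem exists_shift_eq (hμ : μ ≠ 0) (z : ℂ) : ∃ x y, shift μ x y = z := by
  have h : (Real.sqrt |μ| : ℝ) ≠ 0 := (Real.sqrt_pos.2 (abs_pos.2 hμ)).ne'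
  refine ⟨-z.im / Real.sqrt |μ|, Real.sign μ * z.re / Real.sqrt |μ|, ?_⟩
  rw [shift]
  push_cast
  have h' : ((Real.sqrt |μ| : ℝ) : ℂ) ≠ 0 := Complex.ofReal_ne_zero.2 h
  field_simp
  rw [sign_sq hμ]
  conv_rhs => rw [← Complex.re_add_im z]
  ring

/-- Translations carry `coh 0` to nonzero multiples of every coherent vector. -/
theorem eq_top_of_coh_zero_mem (hμ : μ ≠ 0) {W : Submodule ℂ L2R} (hW : IsClosed (W : Set L2R))
    (hinv : ∀ g, ∀ v ∈ W, repOp μ g v ∈ W) (h : coh 0 ∈ W) : W = ⊤ := by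
  have h1 : ∀ z, coh z ∈ W := by
    intro z
    obtain ⟨x, y, hxy⟩ := exists_shift_eq hμ z
    have h2 := hinv { s := 0, ax := x, ay := y, φ := 0 } _ h
    rw [repOp_coh, actCoh, mul_zero, zero_add, hxy] at h2
    exact (W.smul_mem_iff (Complex.exp_ne_zero _)).1 h2
  have h3 : cohSpan ≤ W := Submodule.span_le.2 (by rintro _ ⟨z, rfl⟩; exact h1 z)
  rw [← SetLike.coe_set_eq, Submodule.top_coe, ← hW.closure_eq]
  exact (dense_cohSpan.mono h3).closure_eq

theorem repOp_mem_orthogonal (hμ : μ ≠ 0) {W : Submodule ℂ L2R}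
    (hinv : ∀ g, ∀ v ∈ W, repOp μ g v ∈ W) (g : EBar) (v : L2R) (hv : v ∈ Wᗮ) :
    repOp μ g v ∈ Wᗮ := by
  rw [Submodule.mem_orthogonal] at hv ⊢
  intro u hu
  have h1 : u = repOp μ g (repOp μ g⁻¹ u) := by
    rw [← mul_apply_eq_comp, ← repOp_mul hμ, mul_inv_cancel, repOp_one]; rfl
  rw [h1, inner_repOp]
  exact hv _ (hinv _ _ hu)

theorem coh_zero_ne_zero : coh 0 ≠ 0 := by
  intro h
  have h1 := inner_coh 0 0
  rw [h, inner_zero_left] at h1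
  have : (Real.sqrt Real.pi : ℝ) ≠ 0 := (Real.sqrt_pos.2 Real.pi_pos).ne'
  rw [map_zero, zero_mul, zero_div, Complex.exp_zero, mul_one] at h1
  exact this (Complex.ofReal_eq_zero.1 h1.symm)

theorem rep_isIrreducible (hμ : μ ≠ 0) : (rep hμ).IsIrreducible := by
  refine ⟨⟨coh 0, 0, coh_zero_ne_zero⟩, fun W hW hinv => ?_⟩
  simp only [rep_op] at hinv
  have hinv' := repOp_mem_orthogonal hμ hinv
  have : CompleteSpace W := hW.completeSpace_coe
  obtain ⟨a, ha, b, hb, hab⟩ := W.exists_add_mem_mem_orthogonal (coh 0)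
  have heig : ∀ φ, repOp μ (expJ φ) a =
      Complex.exp (Complex.I * (Real.sign μ * φ) / 2) • a := by
    intro φ
    set c := Complex.exp (Complex.I * (Real.sign μ * φ) / 2)
    have h0 : repOp μ (expJ φ) (coh 0) = c • coh 0 := by
      rw [repOp_expJ_coh, mul_zero]
    rw [hab, map_add, smul_add] at h0
    -- The eigenvector equation for a + b splits: the defect of a lies in W and equals minus the
    -- defect of b, which lies in Wᗮ.
    have h1 : repOp μ (expJ φ) a - c • a = c • b - repOp μ (expJ φ) b := by
      rw [sub_eq_sub_iff_add_eq_add, h0, add_comm]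
    have h2 : repOp μ (expJ φ) a - c • a ∈ W := W.sub_mem (hinv _ _ ha) (W.smul_mem _ ha)
    have h3 : repOp μ (expJ φ) a - c • a ∈ Wᗮ := by
      rw [h1]; exact Wᗮ.sub_mem (Wᗮ.smul_mem _ hb) (hinv' _ _ hb)
    rw [← sub_eq_zero]
    exact Submodule.disjoint_def.1 W.orthogonal_disjoint _ h2 h3
  obtain ⟨c, hc⟩ := eq_smul_coh_zero hμ heig
  rcases eq_or_ne c 0 with h0 | h0
  · left
    rw [hc, h0, zero_smul, zero_add] at hab
    have h1 := eq_top_of_coh_zero_mem hμ (W.isClosed_orthogonal) hinv' (hab ▸ hb)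
    exact (Submodule.orthogonal_eq_top_iff _).1 h1
  · right
    refine eq_top_of_coh_zero_mem hμ hW hinv ?_
    rw [hc] at ha
    exact (W.smul_mem_iff h0).1 ha

end EBar

/-! ### Position and momentum operators -/

section PositionMomentum

theorem mem_positionOp_graph {v w : L2R} :
    (v, w) ∈ positionOp.graph ↔ ∀ᵐ x : ℝ, w x = x * v x := by
  rw [LinearPMap.mem_graph_iff]
  constructor
  · rintro ⟨⟨y, hy⟩, rfl, h⟩
    have h' : positionOp ⟨y, hy⟩ = w := h
    rw [← h']
    exact MemLp.coeFn_toLp hy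
  · intro h
    have hv : MemLp (fun x : ℝ => (x : ℂ) * v x) 2 volume :=
      (memLp_congr_ae h).1 (Lp.memLp w)
    refine ⟨⟨v, hv⟩, rfl, ?_⟩
    apply Lp.ext
    filter_upwards [MemLp.coeFn_toLp hv, h] with x h1 h2
    rw [h2]
    exact h1

theorem mem_momentumOp_graph {v w : L2R} :
    (v, w) ∈ momentumOp.graph ↔ IsWeakDeriv v (Complex.I • w) := by
  rw [LinearPMap.mem_graph_iff]
  constructor
  · rintro ⟨⟨y, hy⟩, rfl, h⟩
    have h' : (-Complex.I) • Classical.choose hy = w := h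
    have := Classical.choose_spec hy
    rw [← h', smul_smul]
    simpa using this
  · intro h
    refine ⟨⟨v, _, h⟩, rfl, ?_⟩
    change (-Complex.I) • Classical.choose (p := fun w => IsWeakDeriv v w) ⟨_, h⟩ = w
    rw [(Classical.choose_spec (p := fun w => IsWeakDeriv v w) ⟨_, h⟩).unique h, smul_smul]
    simp

theorem positionOp_inner {v w v' w' : L2R} (h : (v, w) ∈ positionOp.graph)
    (h' : (v', w') ∈ positionOp.graph) : inner ℂ w v' = inner ℂ v w' := by
  rw [mem_positionOp_graph] at h h'
  rw [L2.inner_def, L2.inner_def]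
  refine integral_congr_ae ?_
  filter_upwards [h, h'] with x h1 h2
  rw [h1, h2]
  simp only [RCLike.inner_apply, map_mul, Complex.conj_ofReal]
  ring

theorem positionOp_closed {v w : ℕ → L2R} {v₀ w₀ : L2R}
    (h : ∀ n, (v n, w n) ∈ positionOp.graph)
    (hv : Tendsto v atTop (𝓝 v₀)) (hw : Tendsto w atTop (𝓝 w₀)) :
    (v₀, w₀) ∈ positionOp.graph := by
  rw [mem_positionOp_graph]
  -- L² convergence gives almost everywhere convergence along a subsequence; a second extraction
  -- serves both sequences at once.
  obtain ⟨k, hk, hk'⟩ := (tendstoInMeasure_of_tendsto_Lp hv).exists_seq_tendsto_ae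
  obtain ⟨l, hl, hl'⟩ := (tendstoInMeasure_of_tendsto_Lp
    (hw.comp hk.tendsto_atTop)).exists_seq_tendsto_ae
  have hall : ∀ᵐ x : ℝ, ∀ n, w n x = x * v n x :=
    ae_all_iff.2 fun n => mem_positionOp_graph.1 (h n)
  filter_upwards [hk', hl', hall] with x h1 h2 h3
  have h4 := (h1.comp hl.tendsto_atTop).const_mul (x : ℂ)
  refine tendsto_nhds_unique h2 (h4.congr fun n => ?_)
  simp [h3]

theorem tendsto_integral_test {g : ℝ → ℝ} (hg : Continuous g) (hc : HasCompactSupport g)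
    {v : ℕ → L2R} {v₀ : L2R} (hv : Tendsto v atTop (𝓝 v₀)) :
    Tendsto (fun n => ∫ x, g x • v n x) atTop (𝓝 (∫ x, g x • v₀ x)) := by
  have hG : MemLp (fun x => (g x : ℂ)) 2 volume :=
    (hg.memLp_of_hasCompactSupport (p := 2) hc).ofReal (K := ℂ)
  have h : ∀ v : L2R, ∫ x, g x • v x = inner ℂ hG.toLp v := by
    intro v
    rw [L2.inner_def]
    refine integral_congr_ae ?_
    filter_upwards [hG.coeFn_toLp] with x hx
    rw [hx]
    simp [mul_comm]
  simp only [h]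
  exact tendsto_const_nhds.inner hv

/-- Both sides of the weak derivative identity are continuous in L² for a fixed test function. -/
theorem momentumOp_closed {v w : ℕ → L2R} {v₀ w₀ : L2R}
    (h : ∀ n, (v n, w n) ∈ momentumOp.graph)
    (hv : Tendsto v atTop (𝓝 v₀)) (hw : Tendsto w atTop (𝓝 w₀)) :
    (v₀, w₀) ∈ momentumOp.graph := by
  rw [mem_momentumOp_graph]
  intro g hg hc
  refine tendsto_nhds_unique
    (tendsto_integral_test (hg.continuous_deriv (by simp)) hc.deriv hv) ?_
  refine ((tendsto_integral_test hg.continuous hc (hw.const_smul Complex.I)).neg).congr fun n => ?_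
  exact (mem_momentumOp_graph.1 (h n) g hg hc).symm

theorem MemLp.integrable_smul_L2 {f : ℝ → ℝ} (hf : MemLp f 2 volume) (u : L2R) :
    Integrable fun x => f x • u x :=
  ((hf.ofReal (K := ℂ)).integrable_mul (Lp.memLp u)).congr
    (Eventually.of_forall fun _ => (Complex.real_smul).symm)

/-- Integration by parts against square integrable smooth functions, by cutting them off. -/
theorem IsWeakDeriv.integral_deriv_smul {v w : L2R} (h : IsWeakDeriv v w) {g : ℝ → ℝ}
    (hg : ContDiff ℝ ∞ g) (hg2 : MemLp g 2 volume) (hg2' : MemLp (deriv g) 2 volume) :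
    ∫ x, deriv g x • v x = -∫ x, g x • w x := by
  let χ : ContDiffBump (0 : ℝ) := ⟨1, 2, one_pos, one_lt_two⟩
  have hχ : ContDiff ℝ ∞ χ := χ.contDiff
  have hχc : HasCompactSupport (deriv χ) := χ.hasCompactSupport.deriv
  obtain ⟨C, hC⟩ := hχc.exists_bound_of_continuous (hχ.continuous_deriv (by simp))
  have hC0 : 0 ≤ C := (norm_nonneg _).trans (hC 0)
  -- The cutoffs χ(εx) tend to 1 while their derivatives are at most εC; ε ≤ 1 yields a dominating
  -- function independent of n.
  let ε : ℕ → ℝ := fun n => 1 / ((n : ℝ) + 1)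
  have hε0 : ∀ n, 0 < ε n := fun n => by positivity
  have hε1 : ∀ n, ε n ≤ 1 := fun n => by
    rw [div_le_one (by positivity)]; linarith [n.cast_nonneg (α := ℝ)]
  have hε : Tendsto ε atTop (𝓝 0) := tendsto_one_div_add_atTop_nhds_zero_nat
  have hεx : ∀ x : ℝ, Tendsto (fun n => χ (ε n * x)) atTop (𝓝 1) := by
    intro x
    have h1 : Tendsto (fun n => ε n * x) atTop (𝓝 0) := by simpa using hε.mul_const x
    have h2 := (χ.continuous.tendsto 0).comp h1
    rwa [χ.one_of_mem_closedBall (by simp [χ])] at h2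
  have hd : ∀ n x, HasDerivAt (fun x => χ (ε n * x) * g x)
      (ε n * deriv χ (ε n * x) * g x + χ (ε n * x) * deriv g x) x := by
    intro n x
    have h1 : HasDerivAt (fun x => ε n * x) (ε n) x := by
      simpa using (hasDerivAt_id x).const_mul (ε n)
    have h2 := ((hχ.differentiable (by simp)) (ε n * x)).hasDerivAt.comp x h1
    have h3 := h2.mul ((hg.differentiable (by simp)) x).hasDerivAt
    exact h3.congr_deriv (by simp only [Function.comp]; ring)
  have key : ∀ n, ∫ x, (ε n * deriv χ (ε n * x) * g x + χ (ε n * x) * deriv g x) • v x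
      = -∫ x, (χ (ε n * x) * g x) • w x := by
    intro n
    have h1 := h (fun x => χ (ε n * x) * g x)
      ((hχ.comp (contDiff_const.mul contDiff_id)).mul hg)
      ((χ.hasCompactSupport.comp_homeomorph (Homeomorph.mulLeft₀ (ε n) (hε0 n).ne')).mul_right)
    simpa only [(hd n _).deriv] using h1
  have hmeas : ∀ (u : L2R), AEStronglyMeasurable u volume := fun u => Lp.aestronglyMeasurable u
  have hcd : Continuous (deriv χ) := hχ.continuous_deriv (by simp)
  have hcg : Continuous (deriv g) := hg.continuous_deriv (by simp)
  have hχn := χ.continuous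
  have hgc := hg.continuous
  have lim1 : Tendsto (fun n => ∫ x, (ε n * deriv χ (ε n * x) * g x + χ (ε n * x) * deriv g x) • v x)
      atTop (𝓝 (∫ x, deriv g x • v x)) := by
    refine tendsto_integral_of_dominated_convergence
      (fun x => C * ‖g x • v x‖ + ‖deriv g x • v x‖) ?_ ?_ ?_ ?_
    · intro n
      have : Continuous fun x => ε n * deriv χ (ε n * x) * g x + χ (ε n * x) * deriv g x := by
        fun_prop
      exact this.aestronglyMeasurable.smul (hmeas v)
    · exact ((MemLp.integrable_smul_L2 hg2 v).norm.const_mul C).add (MemLp.integrable_smul_L2 hg2' v).norm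
    · intro n
      refine Eventually.of_forall fun x => ?_
      rw [add_smul]
      refine (norm_add_le _ _).trans (add_le_add ?_ ?_)
      · rw [mul_smul, norm_smul]
        refine mul_le_mul_of_nonneg_right ?_ (norm_nonneg _)
        rw [norm_mul, Real.norm_of_nonneg (hε0 n).le]
        exact (mul_le_of_le_one_left (norm_nonneg _) (hε1 n)).trans (hC _)
      · rw [mul_smul, norm_smul, Real.norm_of_nonneg χ.nonneg]
        exact mul_le_of_le_one_left (norm_nonneg _) χ.le_one
    · refine Eventually.of_forall fun x => ?_
      have h1 : Tendsto (fun n => ε n * deriv χ (ε n * x)) atTop (𝓝 0) := by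
        refine squeeze_zero_norm (a := fun n => ε n * C) (fun n => ?_) (by simpa using hε.mul_const C)
        rw [norm_mul, Real.norm_of_nonneg (hε0 n).le]
        exact mul_le_mul_of_nonneg_left (hC _) (hε0 n).le
      have h2 := ((h1.mul_const (g x)).add ((hεx x).mul_const (deriv g x))).smul_const (v x)
      simpa using h2
  have lim2 : Tendsto (fun n => ∫ x, (χ (ε n * x) * g x) • w x) atTop (𝓝 (∫ x, g x • w x)) := by
    refine tendsto_integral_of_dominated_convergence (fun x => ‖g x • w x‖) ?_ ?_ ?_ ?_
    · intro n
      have : Continuous fun x => χ (ε n * x) * g x := by fun_prop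
      exact this.aestronglyMeasurable.smul (hmeas w)
    · exact (MemLp.integrable_smul_L2 hg2 w).norm
    · intro n
      refine Eventually.of_forall fun x => ?_
      rw [mul_smul, norm_smul, Real.norm_of_nonneg χ.nonneg]
      exact mul_le_of_le_one_left (norm_nonneg _) χ.le_one
    · refine Eventually.of_forall fun x => ?_
      simpa using ((hεx x).mul_const (g x)).smul_const (w x)
  exact tendsto_nhds_unique lim1 (lim2.neg.congr fun n => (key n).symm)

theorem IsWeakDeriv.integral_deriv_mul {v w : L2R} (h : IsWeakDeriv v w) {g g' : ℝ → ℂ}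
    (hg : ContDiff ℝ ∞ g) (hd : ∀ x, HasDerivAt g (g' x) x)
    (hg2 : MemLp g 2 volume) (hg2' : MemLp g' 2 volume) :
    ∫ x, g' x * v x = -∫ x, g x * w x := by
  have hsplit : ∀ (f : ℝ → ℂ) (u : L2R), MemLp f 2 volume → ∫ x, f x * u x =
      (∫ x, (f x).re • u x) + Complex.I * ∫ x, (f x).im • u x := by
    intro f u hf
    have hre : MemLp (fun x => (f x).re) 2 volume := hf.re
    have him : MemLp (fun x => (f x).im) 2 volume := hf.im
    rw [← integral_const_mul, ← integral_add (MemLp.integrable_smul_L2 hre u)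
      ((MemLp.integrable_smul_L2 him u).const_mul _)]
    refine integral_congr_ae (Eventually.of_forall fun x => ?_)
    change f x * u x = (f x).re • u x + Complex.I * ((f x).im • u x)
    conv_lhs => rw [← Complex.re_add_im (f x)]
    simp only [Complex.real_smul]
    ring
  have hre : ∀ x, HasDerivAt (fun x => (g x).re) (g' x).re x := fun x =>
    Complex.reCLM.hasFDerivAt.comp_hasDerivAt x (hd x)
  have him : ∀ x, HasDerivAt (fun x => (g x).im) (g' x).im x := fun x =>
    Complex.imCLM.hasFDerivAt.comp_hasDerivAt x (hd x)
  have dre : deriv (fun x => (g x).re) = fun x => (g' x).re := funext fun x => (hre x).deriv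
  have dim : deriv (fun x => (g x).im) = fun x => (g' x).im := funext fun x => (him x).deriv
  have h1 := h.integral_deriv_smul (g := fun x => (g x).re) (Complex.reCLM.contDiff.comp hg)
    hg2.re (by rw [dre]; exact hg2'.re)
  have h2 := h.integral_deriv_smul (g := fun x => (g x).im) (Complex.imCLM.contDiff.comp hg)
    hg2.im (by rw [dim]; exact hg2'.im)
  rw [dre] at h1
  rw [dim] at h2
  rw [hsplit g' v hg2', hsplit g w hg2, h1, h2]
  ring

end PositionMomentum

/-! ### Position and momentum on complex Gaussians -/

section GaussianOperators

open Polynomial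

theorem gaussVec_mem_positionOp_graph (z : ℂ) (p : ℂ[X]) :
    (gaussVec z p, gaussVec z (X * p)) ∈ positionOp.graph := by
  rw [mem_positionOp_graph]
  filter_upwards [coeFn_gaussVec z p, coeFn_gaussVec z (X * p)] with x h1 h2
  rw [h1, h2]
  simp [gaussFun, mul_assoc]

/-- The effect of the derivative on the polynomial factor of `p(x) exp (z x - x² / 2)`. -/
def gaussDeriv (z : ℂ) (p : ℂ[X]) : ℂ[X] := derivative p + (C z - X) * p

theorem hasDerivAt_gaussFun (z : ℂ) (p : ℂ[X]) (x : ℝ) :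
    HasDerivAt (gaussFun p z) (gaussFun (gaussDeriv z p) z x) x := by
  have h1 := (p.hasDerivAt (x : ℂ)).comp_ofReal
  have h2 : HasDerivAt (fun x : ℂ => Complex.exp (z * x - x ^ 2 / 2)) _ (x : ℂ) :=
    (((hasDerivAt_id (x : ℂ)).const_mul z).sub (((hasDerivAt_id (x : ℂ)).pow 2).div_const 2)).cexp
  refine (h1.mul h2.comp_ofReal).congr_deriv ?_
  simp [gaussFun, gaussDeriv]
  ring

theorem contDiff_gaussFun (z : ℂ) (p : ℂ[X]) : ContDiff ℝ ∞ (gaussFun p z) := by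
  unfold gaussFun
  have h1 : ContDiff ℝ ∞ (fun x : ℝ => (x : ℂ)) := Complex.ofRealCLM.contDiff
  have h2 : ContDiff ℝ ∞ (fun x : ℝ => p.eval (x : ℂ)) := by
    simp only [Polynomial.eval_eq_sum_range]
    exact ContDiff.sum fun i _ => contDiff_const.mul (h1.pow i)
  have h3 : ContDiff ℝ ∞ (fun x : ℝ => z * (x : ℂ) - (x : ℂ) ^ 2 / 2) :=
    (contDiff_const.mul h1).sub ((h1.pow 2).div_const 2)
  exact h2.mul h3.cexp

theorem isWeakDeriv_gaussVec (z : ℂ) (p : ℂ[X]) :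
    IsWeakDeriv (gaussVec z p) (gaussVec z (gaussDeriv z p)) := by
  intro g hg hc
  have h1 : ∀ (f : ℝ → ℝ) (q : ℂ[X]), ∫ x, f x • gaussVec z q x = ∫ x, (f x : ℂ) * gaussFun q z x := by
    intro f q
    refine integral_congr_ae ?_
    filter_upwards [coeFn_gaussVec z q] with x hx
    rw [hx, Complex.real_smul]
  have hi : ∀ (f : ℝ → ℝ) (q : ℂ[X]), Continuous f → HasCompactSupport f →
      Integrable (fun x => (f x : ℂ) * gaussFun q z x) := by
    intro f q hf hfc
    refine Continuous.integrable_of_hasCompactSupport ?_ ?_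
    · exact (Complex.continuous_ofReal.comp hf).mul (continuous_gaussFun q z)
    · exact (hfc.comp_left (g := ((↑) : ℝ → ℂ)) (by simp)).mul_right
  have hcd : Continuous (deriv g) := hg.continuous_deriv (by simp)
  rw [h1, h1, eq_neg_iff_add_eq_zero, ← neg_eq_iff_add_eq_zero]
  refine (integral_mul_deriv_eq_deriv_mul_of_integrable (u := fun x => (g x : ℂ))
    (u' := fun x => ((deriv g x : ℝ) : ℂ)) (v := gaussFun p z) (fun x _ => ?_)
    (fun x _ => hasDerivAt_gaussFun z p x) (hi g _ hg.continuous hc) (hi _ _ hcd hc.deriv)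
    (hi g _ hg.continuous hc)).symm
  exact ((hg.differentiable (by simp)) x).hasDerivAt.ofReal_comp

theorem gaussVec_mem_momentumOp_graph (z : ℂ) (p : ℂ[X]) :
    (gaussVec z p, gaussVec z (-Complex.I • gaussDeriv z p)) ∈ momentumOp.graph := by
  rw [mem_momentumOp_graph, map_smul, smul_smul]
  simpa using isWeakDeriv_gaussVec z p

theorem conj_gaussFun_one (z : ℂ) (x : ℝ) :
    starRingEnd ℂ (gaussFun 1 z x) = gaussFun 1 (starRingEnd ℂ z) x := by
  have : (starRingEnd ℂ) 2 = 2 := Complex.conj_ofNat 2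
  simp [gaussFun, ← Complex.exp_conj, this]

/-- Symmetry against an arbitrary v in the domain of `momentumOp`: the Gaussian is not compactly
supported, so the weak derivative is tested with it through `IsWeakDeriv.integral_deriv_mul`,
applied to the conjugate Gaussian. -/
theorem inner_gaussVec_momentumOp (z : ℂ) {v w : L2R} (h : (v, w) ∈ momentumOp.graph) :
    inner ℂ (gaussVec z (-Complex.I • gaussDeriv z 1)) v = inner ℂ (gaussVec z 1) w := by
  rw [mem_momentumOp_graph] at h
  have h1 := h.integral_deriv_mul (contDiff_gaussFun (starRingEnd ℂ z) 1)
    (hasDerivAt_gaussFun (starRingEnd ℂ z) 1) (memLp_gaussFun _ _) (memLp_gaussFun _ _)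
  have h2 : inner ℂ (gaussVec z (-Complex.I • gaussDeriv z 1)) v = Complex.I *
      ∫ x, gaussFun (gaussDeriv (starRingEnd ℂ z) 1) (starRingEnd ℂ z) x * v x := by
    rw [← integral_const_mul, L2.inner_def]
    refine integral_congr_ae ?_
    filter_upwards [coeFn_gaussVec z (-Complex.I • gaussDeriv z 1)] with x hx
    have h3 := conj_gaussFun_one z x
    simp only [gaussFun, eval_one, one_mul] at h3
    rw [hx, gaussFun_smul]
    simp only [gaussFun, gaussDeriv, RCLike.inner_apply, Pi.smul_apply, smul_eq_mul, map_mul, h3,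
      derivative_one, zero_add, mul_one, eval_sub, eval_C, eval_X, map_sub, map_neg, Complex.conj_I,
      Complex.conj_ofReal]
    ring
  have h3 : inner ℂ (gaussVec z 1) w = -Complex.I *
      ∫ x, gaussFun 1 (starRingEnd ℂ z) x * (Complex.I • w : L2R) x := by
    rw [← integral_const_mul, L2.inner_def]
    refine integral_congr_ae ?_
    filter_upwards [coeFn_gaussVec z 1, Lp.coeFn_smul Complex.I w] with x hx hx'
    rw [hx, hx', ← conj_gaussFun_one]
    simp only [RCLike.inner_apply, Pi.smul_apply, smul_eq_mul]
    linear_combination (w x * starRingEnd ℂ (gaussFun 1 z x)) * Complex.I_sq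
  rw [h2, h3, h1]
  ring

end GaussianOperators

/-! ### Generators of the representation -/

theorem LinearPMap.mem_smul_graph {H : Type*} [AddCommGroup H] [Module ℂ H] {A : H →ₗ.[ℂ] H}
    {c : ℂ} {v w : H} : (v, w) ∈ (c • A).graph ↔ ∃ u, (v, u) ∈ A.graph ∧ c • u = w := by
  rw [LinearPMap.smul_graph, Submodule.mem_map]
  constructor
  · rintro ⟨⟨a, b⟩, hab, h⟩
    obtain ⟨rfl, rfl⟩ := Prod.ext_iff.1 h
    exact ⟨b, hab, rfl⟩
  · rintro ⟨u, hu, rfl⟩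
    exact ⟨(v, u), hu, rfl⟩

namespace EBar

open Polynomial

variable {μ : ℝ}

theorem repOp_mem_cohSpan (g : EBar) {v : L2R} (hv : v ∈ cohSpan) : repOp μ g v ∈ cohSpan := by
  induction hv using Submodule.span_induction with
  | mem v hv =>
    obtain ⟨z, rfl⟩ := hv
    rw [repOp_coh, actCoh]
    exact cohSpan.smul_mem _ (coh_mem_cohSpan _)
  | zero => simp
  | add a b _ _ ha hb => rw [map_add]; exact cohSpan.add_mem ha hb
  | smul c a _ ha => rw [map_smul]; exact cohSpan.smul_mem c ha

theorem isUnitaryGroup_repOp (hμ : μ ≠ 0) {γ : ℝ → EBar} (h0 : γ 0 = 1)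
    (hadd : ∀ s t, γ (s + t) = γ s * γ t) (hγ : Continuous γ) :
    IsUnitaryGroup fun t => repOp μ (γ t) where
  zero := by rw [h0, repOp_one]
  add s t v := by rw [hadd, repOp_mul hμ]; rfl
  inner_map t := inner_repOp (γ t)
  continuous_apply v := (continuous_repOp v).comp hγ

/-- Reduces `IsUnitaryGroup.generator_eq` to single coherent vectors. The scalar c is real for the
symmetry of c • A and nonzero so that closedness passes from A to c • A. -/
theorem generator_repOp_eq {γ : ℝ → EBar}
    (hU : IsUnitaryGroup fun t => repOp μ (γ t)) {A : L2R →ₗ.[ℂ] L2R} {c : ℝ} (hc : c ≠ 0)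
    (hcoh : ∀ z, ∃ w, (coh z, w) ∈ A.graph ∧
      HasDerivAt (fun t => actCoh μ (γ t) z) (-Complex.I • (c : ℂ) • w) 0 ∧
      ∀ v' w', (v', w') ∈ A.graph → inner ℂ w v' = inner ℂ (coh z) w')
    (hclosed : ∀ (v w : ℕ → L2R) (v₀ w₀ : L2R), (∀ n, v n ∈ cohSpan) →
      (∀ n, (v n, w n) ∈ A.graph) → Tendsto v atTop (𝓝 v₀) → Tendsto w atTop (𝓝 w₀) →
      (v₀, w₀) ∈ A.graph) :
    generator (fun t => repOp μ (γ t)) = (c : ℂ) • A := by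
  have hc' : (c : ℂ) ≠ 0 := Complex.ofReal_ne_zero.2 hc
  refine hU.generator_eq dense_cohSpan (fun v hv t => repOp_mem_cohSpan _ hv) ?_ ?_ ?_
  · have h1 : cohSpan ≤ ((((c : ℂ) • A).graph ⊓
        (generator (fun t => repOp μ (γ t))).graph).map (LinearMap.fst ℂ L2R L2R)) := by
      refine Submodule.span_le.2 ?_
      rintro _ ⟨z, rfl⟩
      obtain ⟨w, hw, hd, -⟩ := hcoh z
      refine ⟨(coh z, (c : ℂ) • w), ⟨LinearPMap.mem_smul_graph.2 ⟨w, hw, rfl⟩, ?_⟩, rfl⟩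
      rw [SetLike.mem_coe, mem_generator_graph]
      simp only [repOp_coh]
      exact hd
    intro v hv
    obtain ⟨⟨_, w⟩, hw, rfl⟩ := h1 hv
    exact ⟨w, hw⟩
  · have h1 : ∀ v ∈ cohSpan, ∃ w, (v, w) ∈ A.graph ∧
        ∀ v' w', (v', w') ∈ A.graph → inner ℂ w v' = inner ℂ v w' := by
      intro v hv
      induction hv using Submodule.span_induction with
      | mem v hv =>
        obtain ⟨z, rfl⟩ := hv
        obtain ⟨w, hw, -, hs⟩ := hcoh z
        exact ⟨w, hw, hs⟩
      | zero => exact ⟨0, A.graph.zero_mem, by simp⟩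
      | add a b _ _ ha hb =>
        obtain ⟨a', ha, hsa⟩ := ha
        obtain ⟨b', hb, hsb⟩ := hb
        refine ⟨a' + b', A.graph.add_mem ha hb, fun v' w' h => ?_⟩
        rw [inner_add_left, inner_add_left, hsa _ _ h, hsb _ _ h]
      | smul k a _ ha =>
        obtain ⟨a', ha, hsa⟩ := ha
        refine ⟨k • a', A.graph.smul_mem k ha, fun v' w' h => ?_⟩
        rw [inner_smul_left, inner_smul_left, hsa _ _ h]
    intro v hv w hw v' w' hw'
    obtain ⟨u, hu, rfl⟩ := LinearPMap.mem_smul_graph.1 hw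
    obtain ⟨u', hu', rfl⟩ := LinearPMap.mem_smul_graph.1 hw'
    obtain ⟨u₁, hu₁, hs⟩ := h1 v hv
    rw [LinearPMap.mem_graph_snd_inj _ hu hu₁ rfl, inner_smul_left, inner_smul_right, hs _ _ hu',
      Complex.conj_ofReal]
  · intro v w v₀ w₀ hv hw hv₀ hw₀
    refine LinearPMap.mem_smul_graph.2 ⟨(c : ℂ)⁻¹ • w₀, ?_, by rw [smul_inv_smul₀ hc']⟩
    refine hclosed v (fun n => (c : ℂ)⁻¹ • w n) v₀ _ hv (fun n => ?_) hv₀ (hw₀.const_smul _)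
    obtain ⟨u, hu, huw⟩ := LinearPMap.mem_smul_graph.1 (hw n)
    rwa [← huw, inv_smul_smul₀ hc']

/-- Each one-parameter subgroup moves a coherent vector along such a curve, so each generator is
read off from the pair (a', ζ'). -/
theorem hasDerivAt_exp_smul_coh {a ζ : ℝ → ℂ} {a' ζ' z : ℂ} (ha : HasDerivAt a a' 0)
    (hζ : HasDerivAt ζ ζ' 0) (ha0 : a 0 = 0) (hζ0 : ζ 0 = z) :
    HasDerivAt (fun t => Complex.exp (a t) • coh (ζ t))
      (Complex.exp (-z ^ 2 / 4) • gaussVec z (ζ' • (X - C (z / 2)) + a' • 1)) 0 := by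
  have h1 : HasDerivAt (fun t => coh (ζ t)) _ 0 :=
    (hζ0.symm ▸ hasDerivAt_coh z : HasDerivAt coh _ (ζ 0)).scomp (0 : ℝ) hζ
  refine (ha.cexp.smul h1).congr_deriv ?_
  rw [ha0, Complex.exp_zero, one_smul, one_mul, hζ0, coh, map_add, map_smul, map_smul, smul_add,
    smul_comm ζ', smul_comm a']

theorem isUnitaryGroup_expE (hμ : μ ≠ 0) : IsUnitaryGroup fun t => repOp μ (expE t) :=
  isUnitaryGroup_repOp hμ rfl (fun s t => by simp [expE, mul_def, rotX, rotY])
    (continuous_induced_rng.2 (by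
      change Continuous fun t : ℝ => (t, ((0 : ℝ), (0 : ℝ)), (0 : ℝ)); fun_prop))

theorem isUnitaryGroup_expPx (hμ : μ ≠ 0) : IsUnitaryGroup fun t => repOp μ (expPx t) :=
  isUnitaryGroup_repOp hμ rfl (fun s t => by simp [expPx, mul_def, rotX, rotY])
    (continuous_induced_rng.2 (by
      change Continuous fun t : ℝ => ((0 : ℝ), (t, (0 : ℝ)), (0 : ℝ)); fun_prop))

theorem isUnitaryGroup_expPy (hμ : μ ≠ 0) : IsUnitaryGroup fun t => repOp μ (expPy t) :=
  isUnitaryGroup_repOp hμ rfl (fun s t => by simp [expPy, mul_def, rotX, rotY])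
    (continuous_induced_rng.2 (by
      change Continuous fun t : ℝ => ((0 : ℝ), ((0 : ℝ), t), (0 : ℝ)); fun_prop))

theorem isUnitaryGroup_expJ (hμ : μ ≠ 0) : IsUnitaryGroup fun t => repOp μ (expJ t) :=
  isUnitaryGroup_repOp hμ rfl (fun s t => by simp [expJ, mul_def, rotX, rotY])
    (continuous_induced_rng.2 (by
      change Continuous fun t : ℝ => ((0 : ℝ), ((0 : ℝ), (0 : ℝ)), t); fun_prop))

theorem mem_idOp_graph {v w : L2R} : (v, w) ∈ (idOp : L2R →ₗ.[ℂ] L2R).graph ↔ v = w := by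
  rw [LinearPMap.mem_graph_iff]
  constructor
  · rintro ⟨y, rfl, h⟩
    exact h
  · rintro rfl
    exact ⟨⟨v, trivial⟩, rfl, rfl⟩

theorem hasDerivAt_ofReal_mul_const (c : ℂ) : HasDerivAt (fun t : ℝ => (t : ℂ) * c) c 0 := by
  simpa using (Complex.ofRealCLM.hasDerivAt (x := (0 : ℝ))).mul_const c

theorem generator_expE (hμ : μ ≠ 0) :
    generator (fun t => repOp μ (expE t)) = (μ : ℂ) • idOp := by
  refine generator_repOp_eq (isUnitaryGroup_expE hμ) hμ (fun z => ?_) ?_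
  · refine ⟨coh z, mem_idOp_graph.2 rfl, ?_, ?_⟩
    · have h1 := (hasDerivAt_ofReal_mul_const (-Complex.I * μ))
      refine ((hasDerivAt_exp_smul_coh h1 (hasDerivAt_const 0 z) (by simp) rfl).congr_deriv
        ?_).congr_of_eventuallyEq (Eventually.of_forall fun t => ?_)
      · rw [coh, zero_smul, zero_add, map_smul]
        simp only [smul_smul]
        congr 1; ring
      · simp only [actCoh, factor, expE, shift, phase_zero]
        congr 2 <;> simp; ring
    · rintro v' w' h
      rw [mem_idOp_graph.1 h]
  · intro v w v₀ w₀ _ h hv hw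
    rw [mem_idOp_graph]
    refine tendsto_nhds_unique hv (hw.congr fun n => (mem_idOp_graph.1 (h n)).symm)

theorem coh_mem_positionOp_graph (z : ℂ) :
    (coh z, Complex.exp (-z ^ 2 / 4) • gaussVec z X) ∈ positionOp.graph := by
  have := gaussVec_mem_positionOp_graph z 1
  rw [mul_one] at this
  exact positionOp.graph.smul_mem _ this

theorem coh_mem_momentumOp_graph (z : ℂ) :
    (coh z, Complex.exp (-z ^ 2 / 4) • gaussVec z (-Complex.I • gaussDeriv z 1)) ∈
      momentumOp.graph :=
  momentumOp.graph.smul_mem _ (gaussVec_mem_momentumOp_graph z 1)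

theorem gaussDeriv_one (z : ℂ) : gaussDeriv z 1 = C z - X := by simp [gaussDeriv]

theorem hasDerivAt_ofReal_sq_mul (c : ℂ) : HasDerivAt (fun t : ℝ => (t : ℂ) ^ 2 * c) 0 0 := by
  have := ((Complex.ofRealCLM.hasDerivAt (x := (0 : ℝ))).pow 2).mul_const c
  simpa using this

theorem generator_expPx (hμ : μ ≠ 0) :
    generator (fun t => repOp μ (expPx t)) = ((Real.sqrt |μ| : ℝ) : ℂ) • positionOp := by
  refine generator_repOp_eq (isUnitaryGroup_expPx hμ) (Real.sqrt_pos.2 (abs_pos.2 hμ)).ne'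
    (fun z => ⟨_, coh_mem_positionOp_graph z, ?_, fun v' w' h =>
      positionOp_inner (coh_mem_positionOp_graph z) h⟩)
    (fun v w v₀ w₀ _ h hv hw => positionOp_closed h hv hw)
  set κ : ℂ := ((Real.sqrt |μ| : ℝ) : ℂ) with hκ
  have hκc : starRingEnd ℂ κ = κ := Complex.conj_ofReal _
  have h1 := (hasDerivAt_ofReal_sq_mul (-κ ^ 2 / 4)).add
    (hasDerivAt_ofReal_mul_const (-z * κ * Complex.I / 2))
  have h2 := (hasDerivAt_ofReal_mul_const (-Complex.I * κ)).const_add z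
  refine ((hasDerivAt_exp_smul_coh (z := z) h1 h2 (by simp) (by simp)).congr_deriv
    ?_).congr_of_eventuallyEq (Eventually.of_forall fun t => ?_)
  -- The velocity of the factor cancels the constant term of the label derivative, leaving
  -- multiplication by -iκx.
  · have : (-Complex.I * κ) • (X - C (z / 2)) + (0 + -z * κ * Complex.I / 2) • (1 : ℂ[X])
        = (-Complex.I * κ) • X + (0 : ℂ) • 1 := by
      rw [smul_sub, ← mul_one (C (z / 2)), ← smul_eq_C_mul, smul_smul, sub_add, ← sub_smul,
        sub_eq_add_neg, ← neg_smul]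
      congr 2; ring
    rw [this, zero_smul, add_zero, map_smul]
    simp only [smul_smul]
    congr 1; ring
  · simp only [actCoh, factor, expPx, shift, phase_zero, ← hκ, Pi.add_apply, map_mul, map_sub,
      Complex.conj_I, Complex.ofReal_zero, map_zero, hκc,
      Complex.conj_ofReal]
    congr 2
    · linear_combination (κ ^ 2 * t ^ 2 / 4) * Complex.I_sq
    · ring

theorem inner_coh_momentumOp (z : ℂ) {v w : L2R} (h : (v, w) ∈ momentumOp.graph) :
    inner ℂ (Complex.exp (-z ^ 2 / 4) • gaussVec z (-Complex.I • gaussDeriv z 1)) v =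
      inner ℂ (coh z) w := by
  rw [coh, inner_smul_left, inner_smul_left, inner_gaussVec_momentumOp z h]

theorem sign_mul_sqrt_ne_zero (hμ : μ ≠ 0) : Real.sign μ * Real.sqrt |μ| ≠ 0 :=
  mul_ne_zero (mt Real.sign_eq_zero_iff.1 hμ) (Real.sqrt_pos.2 (abs_pos.2 hμ)).ne'

theorem generator_expPy (hμ : μ ≠ 0) : generator (fun t => repOp μ (expPy t)) =
    ((Real.sign μ * Real.sqrt |μ| : ℝ) : ℂ) • momentumOp := by
  refine generator_repOp_eq (isUnitaryGroup_expPy hμ) (sign_mul_sqrt_ne_zero hμ)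
    (fun z => ⟨_, coh_mem_momentumOp_graph z, ?_, fun v' w' h => inner_coh_momentumOp z h⟩)
    (fun v w v₀ w₀ _ h hv hw => momentumOp_closed h hv hw)
  set κ : ℂ := ((Real.sign μ * Real.sqrt |μ| : ℝ) : ℂ) with hκ
  have h1 := (hasDerivAt_ofReal_sq_mul (-κ ^ 2 / 4)).add
    (hasDerivAt_ofReal_mul_const (-z * κ / 2))
  have h2 := (hasDerivAt_ofReal_mul_const κ).const_add z
  refine ((hasDerivAt_exp_smul_coh (z := z) h1 h2 (by simp) (by simp)).congr_deriv
    ?_).congr_of_eventuallyEq (Eventually.of_forall fun t => ?_)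
  -- Here the constants add instead, to κ(X - z), which is -κ times the derivative polynomial z - X.
  · have : κ • (X - C (z / 2)) + (0 + -z * κ / 2) • (1 : ℂ[X]) = (-κ) • gaussDeriv z 1 := by
      simp only [gaussDeriv_one, smul_eq_C_mul, C_add, C_neg]
      have : C z = 2 * C (z / 2) := by
        rw [← C_ofNat, ← C_mul]; congr 1; ring
      rw [show -z * κ / 2 = -(z / 2 * κ) by ring, C_neg, C_mul, this, C_0]
      ring
    rw [this, map_smul, map_smul]
    simp only [smul_smul]
    congr 1
    linear_combination (-(κ * Complex.exp (-z ^ 2 / 4))) * Complex.I_sq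
  · simp only [actCoh, factor, expPy, shift, phase_zero, Pi.add_apply, map_mul, map_sub,
      Complex.conj_ofReal, Complex.conj_I, Complex.ofReal_zero, map_zero, hκ, Complex.ofReal_mul]
    congr 2 <;> ring

/-- At μ = 1 the momentum operator is the generator along P₂, and generators are symmetric. -/
theorem momentumOp_inner {v w v' w' : L2R} (h : (v, w) ∈ momentumOp.graph)
    (h' : (v', w') ∈ momentumOp.graph) : inner ℂ w v' = inner ℂ v w' := by
  have hU := isUnitaryGroup_expPy (μ := 1) one_ne_zero
  have hc := sign_mul_sqrt_ne_zero (μ := 1) one_ne_zero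
  have h1 : ∀ {v w : L2R}, (v, w) ∈ momentumOp.graph →
      (v, w) ∈ (generator fun t => repOp 1 (expPy t)).graph := by
    intro v w h
    rw [generator_expPy one_ne_zero]
    exact LinearPMap.mem_smul_graph.2 ⟨w, h, by simp⟩
  exact hU.symmetric (h1 h) (h1 h')

end EBar

/-! ### The harmonic oscillator -/

theorem mem_opMul_graph {H : Type*} [NormedAddCommGroup H] [InnerProductSpace ℂ H]
    {A B : H →ₗ.[ℂ] H} {v w : H} :
    (v, w) ∈ (opMul A B).graph ↔ ∃ u, (v, u) ∈ B.graph ∧ (u, w) ∈ A.graph := by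
  rw [LinearPMap.mem_graph_iff]
  constructor
  · rintro ⟨⟨y, hy, hy'⟩, rfl, h⟩
    refine ⟨B ⟨y, hy⟩, LinearPMap.mem_graph B ⟨y, hy⟩, ?_⟩
    have h' : A ⟨B ⟨y, hy⟩, hy'⟩ = w := h
    rw [← h']
    exact LinearPMap.mem_graph A ⟨B ⟨y, hy⟩, hy'⟩
  · rintro ⟨u, hu, hw⟩
    obtain ⟨⟨y, hy⟩, rfl, h1⟩ := (LinearPMap.mem_graph_iff _).1 hu
    obtain ⟨⟨y', hy'⟩, rfl, h2⟩ := (LinearPMap.mem_graph_iff _).1 hw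
    have h1' : B ⟨y, hy⟩ = y' := h1
    subst h1'
    exact ⟨⟨y, hy, hy'⟩, rfl, h2⟩

theorem LinearPMap.mem_add_graph {H : Type*} [AddCommGroup H] [Module ℂ H]
    {A B : H →ₗ.[ℂ] H} {v w : H} :
    (v, w) ∈ (A + B).graph ↔ ∃ a b, (v, a) ∈ A.graph ∧ (v, b) ∈ B.graph ∧ a + b = w := by
  rw [LinearPMap.mem_graph_iff]
  constructor
  · rintro ⟨⟨y, hy⟩, rfl, h⟩
    exact ⟨A ⟨y, hy.1⟩, B ⟨y, hy.2⟩, LinearPMap.mem_graph A ⟨y, hy.1⟩,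
      LinearPMap.mem_graph B ⟨y, hy.2⟩, h⟩
  · rintro ⟨a, b, ha, hb, rfl⟩
    obtain ⟨⟨y, hy⟩, rfl, rfl⟩ := (LinearPMap.mem_graph_iff _).1 ha
    obtain ⟨⟨y', hy'⟩, h, rfl⟩ := (LinearPMap.mem_graph_iff _).1 hb
    have h' : y' = y := h
    subst h'
    exact ⟨⟨y', hy, hy'⟩, rfl, rfl⟩

theorem mem_oscillatorOp_graph {v w : L2R} : (v, w) ∈ oscillatorOp.graph ↔
    ∃ q q' p p', (v, q) ∈ positionOp.graph ∧ (q, q') ∈ positionOp.graph ∧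
      (v, p) ∈ momentumOp.graph ∧ (p, p') ∈ momentumOp.graph ∧
      (1 / 2 : ℂ) • (q' + p') = w := by
  rw [oscillatorOp, LinearPMap.mem_smul_graph]
  simp only [LinearPMap.mem_add_graph, mem_opMul_graph]
  constructor
  · rintro ⟨_, ⟨q', p', ⟨q, hq, hq'⟩, ⟨p, hp, hp'⟩, rfl⟩, rfl⟩
    exact ⟨q, q', p, p', hq, hq', hp, hp', rfl⟩
  · rintro ⟨q, q', p, p', hq, hq', hp, hp', rfl⟩
    exact ⟨_, ⟨q', p', ⟨q, hq, hq'⟩, ⟨p, hp, hp'⟩, rfl⟩, rfl⟩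

theorem oscillatorOp_inner {v w v' w' : L2R} (h : (v, w) ∈ oscillatorOp.graph)
    (h' : (v', w') ∈ oscillatorOp.graph) : inner ℂ w v' = inner ℂ v w' := by
  obtain ⟨q, r, p, s, hq, hr, hp, hs, rfl⟩ := mem_oscillatorOp_graph.1 h
  obtain ⟨q', r', p', s', hq', hr', hp', hs', rfl⟩ := mem_oscillatorOp_graph.1 h'
  rw [inner_smul_left, inner_smul_right, inner_add_left, inner_add_right,
    positionOp_inner hr hq', positionOp_inner hq hr', EBar.momentumOp_inner hs hp',
    EBar.momentumOp_inner hp hs']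
  congr 1
  simp [Complex.conj_ofNat]

/-! ### Canonical commutation on formal sums and closedness of the oscillator -/

section GaussianAlgebra

open Polynomial

/-- The formal sums of polynomials times complex Gaussians, as vectors of `L²(ℝ)`. -/
def gaussCombination : (ℂ →₀ ℂ[X]) →ₗ[ℂ] L2R := Finsupp.lsum ℂ gaussVec

/-- The position operator on formal sums. -/
def formalPosition : (ℂ →₀ ℂ[X]) →ₗ[ℂ] (ℂ →₀ ℂ[X]) :=
  Finsupp.lsum ℂ fun z => Finsupp.lsingle z ∘ₗ LinearMap.mulLeft ℂ X

/-- The momentum operator on formal sums. -/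
def formalMomentum : (ℂ →₀ ℂ[X]) →ₗ[ℂ] (ℂ →₀ ℂ[X]) :=
  Finsupp.lsum ℂ fun z => Finsupp.lsingle z ∘ₗ
    (-Complex.I • (derivative + LinearMap.mulLeft ℂ (C z - X)))

theorem gaussCombination_single (z : ℂ) (p : ℂ[X]) : gaussCombination (Finsupp.single z p) = gaussVec z p := by
  simp [gaussCombination]

theorem formalPosition_single (z : ℂ) (p : ℂ[X]) :
    formalPosition (Finsupp.single z p) = Finsupp.single z (X * p) := by
  simp [formalPosition]

theorem formalMomentum_single (z : ℂ) (p : ℂ[X]) :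
    formalMomentum (Finsupp.single z p) = Finsupp.single z (-Complex.I • gaussDeriv z p) := by
  rw [formalMomentum, Finsupp.lsum_single]
  rfl

theorem gaussCombination_mem_positionOp_graph (f : ℂ →₀ ℂ[X]) :
    (gaussCombination f, gaussCombination (formalPosition f)) ∈ positionOp.graph := by
  induction f using Finsupp.induction_linear with
  | zero => simp
  | add f g hf hg => simp only [map_add]; exact positionOp.graph.add_mem hf hg
  | single z p =>
    rw [formalPosition_single, gaussCombination_single, gaussCombination_single]
    exact gaussVec_mem_positionOp_graph z p

theorem gaussCombination_mem_momentumOp_graph (f : ℂ →₀ ℂ[X]) :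
    (gaussCombination f, gaussCombination (formalMomentum f)) ∈ momentumOp.graph := by
  induction f using Finsupp.induction_linear with
  | zero => simp
  | add f g hf hg => simp only [map_add]; exact momentumOp.graph.add_mem hf hg
  | single z p =>
    rw [formalMomentum_single, gaussCombination_single, gaussCombination_single]
    exact gaussVec_mem_momentumOp_graph z p

/-- On formal sums both operators are everywhere defined, so the commutation relation is the product
rule for X · p, free of domain questions. -/
theorem formalMomentum_formalPosition (f : ℂ →₀ ℂ[X]) : formalMomentum (formalPosition f) =
    formalPosition (formalMomentum f) - Complex.I • f := by
  induction f using Finsupp.induction_linear with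
  | zero => simp
  | add f g hf hg => simp only [map_add, hf, hg, smul_add]; abel
  | single z p =>
    rw [formalPosition_single, formalMomentum_single, formalMomentum_single, formalPosition_single,
      Finsupp.smul_single, ← Finsupp.single_sub]
    congr 1
    simp only [gaussDeriv, derivative_mul, derivative_X, smul_eq_C_mul, C_neg]
    ring

theorem inner_formalPosition (f g : ℂ →₀ ℂ[X]) :
    inner ℂ (gaussCombination (formalPosition f)) (gaussCombination g) =
      inner ℂ (gaussCombination f) (gaussCombination (formalPosition g)) :=
  positionOp_inner (gaussCombination_mem_positionOp_graph f) (gaussCombination_mem_positionOp_graph g)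

theorem inner_formalMomentum (f g : ℂ →₀ ℂ[X]) :
    inner ℂ (gaussCombination (formalMomentum f)) (gaussCombination g) =
      inner ℂ (gaussCombination f) (gaussCombination (formalMomentum g)) :=
  EBar.momentumOp_inner (gaussCombination_mem_momentumOp_graph f) (gaussCombination_mem_momentumOp_graph g)

/-- Expanding ‖Q²f + P²f‖², the commutation relation turns Re ⟨Q²f, P²f⟩ into ‖QPf‖² - ‖f‖², and the
first term is dropped. -/
theorem norm_sq_add_norm_sq_le (f : ℂ →₀ ℂ[X]) :
    ‖gaussCombination (formalPosition (formalPosition f))‖ ^ 2 +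
      ‖gaussCombination (formalMomentum (formalMomentum f))‖ ^ 2 ≤
    ‖gaussCombination (formalPosition (formalPosition f)) +
      gaussCombination (formalMomentum (formalMomentum f))‖ ^ 2 + 2 * ‖gaussCombination f‖ ^ 2 := by
  set q := formalPosition
  set p := formalMomentum
  have h1 : inner ℂ (gaussCombination (q (q f))) (gaussCombination (p (p f))) =
      inner ℂ (gaussCombination (q (p f))) (gaussCombination (q (p f))) +
        2 * Complex.I * inner ℂ (gaussCombination (q f)) (gaussCombination (p f)) := by
    rw [← inner_formalMomentum]
    have e : p (q (q f)) = q (q (p f)) - (2 * Complex.I) • q f := by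
      simp only [p, q, formalMomentum_formalPosition, map_sub, map_smul, two_mul, add_smul]
      abel
    change inner ℂ (gaussCombination (p (q (q f)))) _ = _
    rw [e, map_sub, inner_sub_left, map_smul, inner_smul_left]
    change inner ℂ (gaussCombination (formalPosition (q (p f)))) _ - _ = _
    rw [inner_formalPosition]
    have : (starRingEnd ℂ) 2 = 2 := Complex.conj_ofNat 2
    rw [map_mul, this, Complex.conj_I]
    ring
  have h2 : inner ℂ (gaussCombination (q f)) (gaussCombination (p f)) -
      inner ℂ (gaussCombination (p f)) (gaussCombination (q f)) =
      Complex.I * inner ℂ (gaussCombination f) (gaussCombination f) := by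
    rw [inner_formalPosition, inner_formalMomentum, formalMomentum_formalPosition, map_sub,
      inner_sub_right, map_smul, inner_smul_right]
    ring
  have h3 : ((inner ℂ (gaussCombination f) (gaussCombination f) : ℂ)).re = ‖gaussCombination f‖ ^ 2 :=
    inner_self_eq_norm_sq (𝕜 := ℂ) _
  have h4 : ((inner ℂ (gaussCombination (q (p f))) (gaussCombination (q (p f))) : ℂ)).re =
      ‖gaussCombination (q (p f))‖ ^ 2 := inner_self_eq_norm_sq (𝕜 := ℂ) _
  -- The difference in `h2` is 2i Im ⟨Qf, Pf⟩, so Im ⟨Qf, Pf⟩ = ‖f‖²/2.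
  have h5 : (2 * Complex.I * inner ℂ (gaussCombination (q f)) (gaussCombination (p f))).re = -‖gaussCombination f‖ ^ 2 := by
    have h6 := congrArg Complex.im h2
    rw [← inner_conj_symm (gaussCombination (p f))] at h6
    simp only [Complex.sub_im, Complex.conj_im, Complex.mul_im, Complex.I_re, Complex.I_im,
      zero_mul, one_mul, zero_add, h3] at h6
    simp only [Complex.mul_re, Complex.mul_im, Complex.I_re, Complex.I_im, Complex.re_ofNat,
      Complex.im_ofNat]
    linarith
  have h7 := norm_add_sq (𝕜 := ℂ) (gaussCombination (q (q f))) (gaussCombination (p (p f)))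
  have h8 : ((inner ℂ (gaussCombination (q (q f))) (gaussCombination (p (p f))) : ℂ)).re =
      ‖gaussCombination (q (p f))‖ ^ 2 - ‖gaussCombination f‖ ^ 2 := by
    rw [h1, Complex.add_re, h4, h5]; ring
  change _ = _ + 2 * ((inner ℂ (gaussCombination (q (q f))) (gaussCombination (p (p f))) : ℂ)).re + _ at h7
  rw [h7, h8]
  nlinarith [sq_nonneg ‖gaussCombination (q (p f))‖]

/-- ‖Qf‖² = ⟨f, Q²f⟩, then Cauchy–Schwarz. This makes Qf converge when f and Q²f do. -/
theorem norm_formalPosition_le (f : ℂ →₀ ℂ[X]) : ‖gaussCombination (formalPosition f)‖ ≤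
    ‖gaussCombination f‖ + ‖gaussCombination (formalPosition (formalPosition f))‖ := by
  have h1 : ‖gaussCombination (formalPosition f)‖ ^ 2 ≤
      ‖gaussCombination f‖ * ‖gaussCombination (formalPosition (formalPosition f))‖ := by
    rw [← inner_self_eq_norm_sq (𝕜 := ℂ), inner_formalPosition]
    exact (RCLike.re_le_norm _).trans (norm_inner_le_norm _ _)
  refine abs_le_of_sq_le_sq' ?_ (by positivity) |>.2
  nlinarith [norm_nonneg (gaussCombination f), norm_nonneg (gaussCombination (formalPosition (formalPosition f)))]

theorem norm_formalMomentum_le (f : ℂ →₀ ℂ[X]) : ‖gaussCombination (formalMomentum f)‖ ≤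
    ‖gaussCombination f‖ + ‖gaussCombination (formalMomentum (formalMomentum f))‖ := by
  have h1 : ‖gaussCombination (formalMomentum f)‖ ^ 2 ≤
      ‖gaussCombination f‖ * ‖gaussCombination (formalMomentum (formalMomentum f))‖ := by
    rw [← inner_self_eq_norm_sq (𝕜 := ℂ), inner_formalMomentum]
    exact (RCLike.re_le_norm _).trans (norm_inner_le_norm _ _)
  refine abs_le_of_sq_le_sq' ?_ (by positivity) |>.2
  nlinarith [norm_nonneg (gaussCombination f), norm_nonneg (gaussCombination (formalMomentum (formalMomentum f)))]

theorem cauchySeq_of_norm_sub_le {E F G : Type*} [NormedAddCommGroup E] [NormedAddCommGroup F]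
    [NormedAddCommGroup G] {a : ℕ → E} {b : ℕ → F} {c : ℕ → G} {K : ℝ}
    (h : ∀ m n, ‖a m - a n‖ ≤ K * (‖b m - b n‖ + ‖c m - c n‖)) (hb : CauchySeq b)
    (hc : CauchySeq c) : CauchySeq a := by
  rw [cauchySeq_iff_tendsto_dist_atTop_0] at hb hc ⊢
  have h1 := (hb.add hc).const_mul K
  rw [add_zero, mul_zero] at h1
  refine squeeze_zero (fun _ => dist_nonneg) (fun n => ?_) h1
  simp only [dist_eq_norm]
  exact h n.1 n.2

theorem cohSpan_le_range_gaussCombination : cohSpan ≤ LinearMap.range gaussCombination := by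
  refine Submodule.span_le.2 ?_
  rintro _ ⟨z, rfl⟩
  refine ⟨Complex.exp (-z ^ 2 / 4) • Finsupp.single z 1, ?_⟩
  rw [map_smul, gaussCombination_single]; rfl

/-- By the estimate on formal sums, convergence of v and w forces Q²v and P²v, hence also Qv and Pv,
to be Cauchy. Closedness of Q and P, applied twice each, then identifies the limits. -/
theorem oscillatorOp_closed {v w : ℕ → L2R} {v₀ w₀ : L2R} (hS : ∀ n, v n ∈ cohSpan)
    (h : ∀ n, (v n, w n) ∈ oscillatorOp.graph)
    (hv : Tendsto v atTop (𝓝 v₀)) (hw : Tendsto w atTop (𝓝 w₀)) :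
    (v₀, w₀) ∈ oscillatorOp.graph := by
  choose f hf using fun n => cohSpan_le_range_gaussCombination (hS n)
  obtain rfl : (fun n => gaussCombination (f n)) = v := funext hf
  set q := formalPosition
  set p := formalMomentum
  have hQ := gaussCombination_mem_positionOp_graph
  have hP := gaussCombination_mem_momentumOp_graph
  have hw' : ∀ n, w n = (1 / 2 : ℂ) • (gaussCombination (q (q (f n))) + gaussCombination (p (p (f n)))) := fun n =>
    LinearPMap.mem_graph_snd_inj _ (h n)
      (mem_oscillatorOp_graph.2 ⟨_, _, _, _, hQ _, hQ _, hP _, hP _, rfl⟩) rfl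
  have hbound : ∀ m n, ‖gaussCombination (q (q (f m))) - gaussCombination (q (q (f n)))‖ ^ 2 +
      ‖gaussCombination (p (p (f m))) - gaussCombination (p (p (f n)))‖ ^ 2 ≤
      (2 * (‖w m - w n‖ + ‖gaussCombination (f m) - gaussCombination (f n)‖)) ^ 2 := by
    intro m n
    have h1 := norm_sq_add_norm_sq_le (f m - f n)
    have h2 : ‖gaussCombination (q (q (f m - f n))) + gaussCombination (p (p (f m - f n)))‖ = 2 * ‖w m - w n‖ := by
      have : gaussCombination (q (q (f m - f n))) + gaussCombination (p (p (f m - f n))) = (2 : ℂ) • (w m - w n) := by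
        rw [hw', hw', ← smul_sub, smul_smul]
        simp only [map_sub]
        norm_num
        abel
      rw [this, norm_smul]
      simp
    change _ ≤ ‖gaussCombination (q (q (f m - f n))) + gaussCombination (p (p (f m - f n)))‖ ^ 2 + _ at h1
    rw [h2] at h1
    simp only [map_sub] at h1
    refine h1.trans ?_
    -- With a, b the two norms, the claim is (2a)² + 2b² ≤ (2(a + b))²; the 2 in 2a undoes the ½ in
    -- `oscillatorOp`.
    nlinarith [norm_nonneg (w m - w n), norm_nonneg (gaussCombination (f m) - gaussCombination (f n)),
      mul_nonneg (norm_nonneg (w m - w n)) (norm_nonneg (gaussCombination (f m) - gaussCombination (f n)))]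
  have cv := hv.cauchySeq
  have cw := hw.cauchySeq
  have cqq : CauchySeq fun n => gaussCombination (q (q (f n))) := by
    refine cauchySeq_of_norm_sub_le (K := 2) (fun m n => ?_) cw cv
    refine abs_le_of_sq_le_sq' ?_ (by positivity) |>.2
    exact (le_add_of_nonneg_right (sq_nonneg _)).trans (hbound m n)
  have cpp : CauchySeq fun n => gaussCombination (p (p (f n))) := by
    refine cauchySeq_of_norm_sub_le (K := 2) (fun m n => ?_) cw cv
    refine abs_le_of_sq_le_sq' ?_ (by positivity) |>.2
    exact (le_add_of_nonneg_left (sq_nonneg _)).trans (hbound m n)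
  have cq : CauchySeq fun n => gaussCombination (q (f n)) := by
    refine cauchySeq_of_norm_sub_le (K := 1) (fun m n => ?_) cv cqq
    rw [one_mul]
    simpa only [map_sub] using norm_formalPosition_le (f m - f n)
  have cp : CauchySeq fun n => gaussCombination (p (f n)) := by
    refine cauchySeq_of_norm_sub_le (K := 1) (fun m n => ?_) cv cpp
    rw [one_mul]
    simpa only [map_sub] using norm_formalMomentum_le (f m - f n)
  obtain ⟨a, ha⟩ := cauchySeq_tendsto_of_complete cq
  obtain ⟨a', ha'⟩ := cauchySeq_tendsto_of_complete cqq
  obtain ⟨b, hb⟩ := cauchySeq_tendsto_of_complete cp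
  obtain ⟨b', hb'⟩ := cauchySeq_tendsto_of_complete cpp
  refine mem_oscillatorOp_graph.2 ⟨a, a', b, b', positionOp_closed (fun n => hQ _) hv ha,
    positionOp_closed (fun n => hQ _) ha ha', momentumOp_closed (fun n => hP _) hv hb,
    momentumOp_closed (fun n => hP _) hb hb', ?_⟩
  exact tendsto_nhds_unique (((ha'.add hb').const_smul (1 / 2 : ℂ)).congr fun n => (hw' n).symm) hw

/-- The polynomial is ½(x² - ((z - x)² - 1)): the quadratic terms of Q² and P² cancel. -/
theorem coh_mem_oscillatorOp_graph (z : ℂ) :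
    (coh z, Complex.exp (-z ^ 2 / 4) •
      gaussVec z (C z * X + C (1 / 2 - z ^ 2 / 2))) ∈ oscillatorOp.graph := by
  refine oscillatorOp.graph.smul_mem _ (?_ : (gaussVec z 1, _) ∈ oscillatorOp.graph)
  refine mem_oscillatorOp_graph.2 ⟨_, _, _, _, gaussVec_mem_positionOp_graph z 1,
    gaussVec_mem_positionOp_graph z _, gaussVec_mem_momentumOp_graph z 1,
    gaussVec_mem_momentumOp_graph z _, ?_⟩
  rw [← map_add, ← map_smul]
  congr 1
  have hI : (C Complex.I : ℂ[X]) * C Complex.I = -1 := by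
    rw [← C_mul, Complex.I_mul_I, C_neg, C_1]
  have h2 : (C (1 / 2) : ℂ[X]) * 2 = 1 := by
    rw [← C_ofNat, ← C_mul]; norm_num
  rw [show (1 / 2 - z ^ 2 / 2 : ℂ) = 1 / 2 * (1 - z ^ 2) by ring]
  simp only [gaussDeriv, smul_eq_C_mul, C_neg, C_mul, C_sub, C_pow, C_1, derivative_mul,
    derivative_sub, derivative_neg, derivative_C, derivative_X, derivative_one, zero_add, mul_one]
  linear_combination (C (1 / 2) * ((C z - X) ^ 2 - 1)) * hI + (C z * X) * h2

end GaussianAlgebra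

/-! ### The generator of rotations -/

namespace EBar

open Polynomial

variable {μ : ℝ}

theorem generator_expJ (hμ : μ ≠ 0) : generator (fun t => repOp μ (expJ t)) =
    ((-Real.sign μ : ℝ) : ℂ) • oscillatorOp := by
  refine generator_repOp_eq (isUnitaryGroup_expJ hμ)
    (neg_ne_zero.2 (mt Real.sign_eq_zero_iff.1 hμ))
    (fun z => ⟨_, coh_mem_oscillatorOp_graph z, ?_, fun v' w' h =>
      oscillatorOp_inner (coh_mem_oscillatorOp_graph z) h⟩)
    (fun v w v₀ w₀ hS h hv hw => oscillatorOp_closed hS h hv hw)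
  set σ : ℂ := ((Real.sign μ : ℝ) : ℂ) with hσ
  have h1 := hasDerivAt_ofReal_mul_const (Complex.I * σ / 2)
  have h2 := ((hasDerivAt_ofReal_mul_const (σ * Complex.I)).cexp).mul_const z
  refine ((hasDerivAt_exp_smul_coh (z := z) h1 h2 (by simp) (by simp)).congr_deriv
    ?_).congr_of_eventuallyEq (Eventually.of_forall fun t => ?_)
  -- With σ the sign of μ, ζ' = iσz and a' = iσ/2, so both sides carry the polynomial iσ(zX + ½ -
  -- z²/2).
  · rw [smul_smul (-Complex.I), smul_comm (-Complex.I * _),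
      ← map_smul (gaussVec z) (-Complex.I * _)]
    congr 2
    have e : (Complex.I * σ / 2 : ℂ) = Complex.I * σ * (1 / 2) := by ring
    have e' : (1 / 2 - z ^ 2 / 2 : ℂ) = 1 / 2 - z * (z / 2) := by ring
    rw [e, e']
    simp only [smul_eq_C_mul, Complex.ofReal_zero, zero_mul, Complex.exp_zero, one_mul, C_mul,
      Complex.ofReal_neg, C_neg, ← hσ, C_sub]
    ring
  · simp only []
    rw [← repOp_coh, repOp_expJ_coh, phase]
    congr 2
    · rw [hσ]; ring
    · rw [hσ, Complex.ofReal_mul, mul_right_comm, mul_comm _ (t : ℂ)]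

end EBar

end

theorem mainTheorem4 (μ : ℝ) (hμ : μ ≠ 0) :
    ∃ π : UnitaryRep EBar L2R,
      π.IsIrreducible ∧
      generator (fun t => π.op (EBar.expE t)) = (μ : ℂ) • idOp ∧
      generator (fun t => π.op (EBar.expPx t)) = ((Real.sqrt |μ| : ℝ) : ℂ) • positionOp ∧
      generator (fun t => π.op (EBar.expPy t)) =
        ((Real.sign μ * Real.sqrt |μ| : ℝ) : ℂ) • momentumOp ∧
      generator (fun t => π.op (EBar.expJ t)) =
        ((-Real.sign μ : ℝ) : ℂ) • oscillatorOp := by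
  exact ⟨EBar.rep hμ, EBar.rep_isIrreducible hμ, EBar.generator_expE hμ, EBar.generator_expPx hμ,
    EBar.generator_expPy hμ, EBar.generator_expJ hμ⟩
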